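/- Call a topological space *paracompact* if every open covering has a locally finite open refinement, and *normal* if any two disjoint closed subsets have disjoint open neighbourhoods; neither notion includes the Hausdorff property. For a topological space $Y$ and a sheaf $\mathcal G$ of abelian groups on $Y$, let $H^n(Y;\mathcal G)$ be sheaf cohomology, i.e. the $n$-th right derived functor of global sections, $H^n(Y;\mathcal G)=\operatorname{Ext}^n(\mathbb Z_Y,\mathcal G)$. For a sheaf $\mathcal F$ of abelian groups on a space $X$ and any subset $B\subseteq X$, write $H^n(B;\mathcal F):=H^n(B;\mathcal F|_B)$, where $\mathcal F|_B$ is the inverse image of $\mathcal F$ on $B$ (with the subspace topology). A *neighbourhood* of $A\subseteq X$ is a set $U\subseteq X$, not necessarily open, whose interior contains $A$. **Theorem.** Let $X$ be an arbitrary topological space and let $A\subseteq X$. Assume that $A$ has a basis of paracompact normal neighbourhoods in $X$, i.e. every neighbourhood of $A$ in $X$ contains a neighbourhood of $A$ which is paracompact and normal as a subspace. Then $A$ is taut in $X$: for every sheaf $\mathcal F$ of abelian groups on $X$ and every $n\ge 0$, the canonical map $$\varinjlim_{U\supseteq A} H^n(U;\mathcal F)\longrightarrow H^n(A;\mathcal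 F)$$ induced by the inclusions $A\subseteq U$ is an isomorphism, where $U$ ranges over all neighbourhoods of $A$ in $X$, ordered by reverse inclusion. -/

import Mathlib

open CategoryTheory Limits TopologicalSpace Opposite Topology

universe u

namespace Taut

section Ext

open CategoryTheory.Abelian CategoryTheory.Abelian.Ext

universe v₁ v₂ v₃ u₁ u₂ u₃ w₁ w₂ w₃

variable {C : Type u₁} [Category.{v₁} C] [Abelian C] [HasExt.{w₁} C] [EnoughInjectives C]
variable {D : Type u₂} [Category.{v₂} D] [Abelian D] [HasExt.{w₂} D]
variable {E : Type u₃} [Category.{v₃} E] [Abelian E] [HasExt.{w₃} E]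

lemma exists_eq_comp_extClass {X Y : C} {n : ℕ} (x : Ext X Y (n + 1)) :
    ∃ (S : ShortComplex C) (hS : S.ShortExact) (e : S.X₁ = Y) (y : Ext X S.X₃ n),
      x = e ▸ y.comp hS.extClass rfl := by
  let S : ShortComplex C := ShortComplex.mk (Injective.ι Y) (cokernel.π (Injective.ι Y))
    (cokernel.condition _)
  have hS : S.ShortExact :=
    { exact := ShortComplex.exact_of_g_is_cokernel _ (cokernelIsCokernel _)
      mono_f := by dsimp [S]; infer_instance
      epi_g := by dsimp [S]; infer_instance }
  refine ⟨S, hS, rfl, ?_⟩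
  obtain ⟨y, hy⟩ := covariant_sequence_exact₁ X hS x (by
    have : Injective S.X₂ := by dsimp [S]; infer_instance
    exact eq_zero_of_injective _) rfl
  exact ⟨y, hy.symm⟩

variable (F G : C ⥤ D) [F.Additive] [PreservesFiniteLimits F] [PreservesFiniteColimits F]
  [G.Additive] [PreservesFiniteLimits G] [PreservesFiniteColimits G]

lemma mapExactFunctor_natTrans (α : F ⟶ G) {X Y : C} {n : ℕ} (x : Ext X Y n) :
    (x.mapExactFunctor F).comp (mk₀ (α.app Y)) (add_zero n) =
      (mk₀ (α.app X)).comp (x.mapExactFunctor G) (zero_add n) := by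
  induction n generalizing Y with
  | zero =>
    obtain ⟨f, rfl⟩ := (mk₀_bijective X Y).2 x
    simp [mapExactFunctor_mk₀]
  | succ n ih =>
    obtain ⟨S, hS, rfl, y, rfl⟩ := exists_eq_comp_extClass x
    dsimp only
    have key : (hS.extClass.mapExactFunctor F).comp (mk₀ (α.app S.X₁)) (add_zero 1) =
        (mk₀ (α.app S.X₃)).comp (hS.extClass.mapExactFunctor G) (zero_add 1) := by
      rw [mapExactFunctor_extClass, mapExactFunctor_extClass]
      exact (hS.map_of_exact F).extClass_naturality (hS.map_of_exact G) (S.mapNatTrans α)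
    rw [mapExactFunctor_comp, mapExactFunctor_comp, comp_assoc_of_third_deg_zero, key,
      ← comp_assoc_of_second_deg_zero, ih y, comp_assoc _ _ _ _ _ (by omega)]

lemma mapExactFunctor_id {X Y : C} {n : ℕ} (x : Ext X Y n) :
    x.mapExactFunctor (𝟭 C) = x := by
  induction n generalizing Y with
  | zero =>
    obtain ⟨f, rfl⟩ := (mk₀_bijective X Y).2 x
    simp [mapExactFunctor_mk₀]
  | succ n ih =>
    obtain ⟨S, hS, rfl, y, rfl⟩ := exists_eq_comp_extClass x
    dsimp only
    have key : hS.extClass.mapExactFunctor (𝟭 C) = hS.extClass := mapExactFunctor_extClass _ hS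
    rw [mapExactFunctor_comp, key, ih y]

variable (G' : D ⥤ E) [G'.Additive] [PreservesFiniteLimits G'] [PreservesFiniteColimits G']

lemma mapExactFunctor_functor_comp {X Y : C} {n : ℕ} (x : Ext X Y n) :
    x.mapExactFunctor (F ⋙ G') = (x.mapExactFunctor F).mapExactFunctor G' := by
  induction n generalizing Y with
  | zero =>
    obtain ⟨f, rfl⟩ := (mk₀_bijective X Y).2 x
    simp [mapExactFunctor_mk₀]
  | succ n ih =>
    obtain ⟨S, hS, rfl, y, rfl⟩ := exists_eq_comp_extClass x
    dsimp only
    have key : hS.extClass.mapExactFunctor (F ⋙ G') =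
        (hS.extClass.mapExactFunctor F).mapExactFunctor G' := by
      rw [mapExactFunctor_extClass, mapExactFunctor_extClass]
      exact (mapExactFunctor_extClass G' (hS.map_of_exact F)).symm
    rw [mapExactFunctor_comp, mapExactFunctor_comp, mapExactFunctor_comp, key, ih y]

end Ext

noncomputable section

/-- Sheaves of abelian groups on `Y` (by definition this is `TopCat.Sheaf AddCommGrpCat Y`). -/
abbrev AbSheaf (Y : TopCat.{u}) : Type (u + 1) :=
  Sheaf (Opens.grothendieckTopology Y) AddCommGrpCat.{u}

section Functors

variable {Y Z : TopCat.{u}} (f : Y ⟶ Z)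

/-- The inverse image functor `f⁻¹` on sheaves of abelian groups. -/
abbrev pull : AbSheaf Z ⥤ AbSheaf Y := (Opens.map f).sheafPullback AddCommGrpCat.{u}
  (Opens.grothendieckTopology Z) (Opens.grothendieckTopology Y)

/-- The direct image functor `f_*` on sheaves of abelian groups. -/
abbrev push : AbSheaf Y ⥤ AbSheaf Z := (Opens.map f).sheafPushforwardContinuous
  AddCommGrpCat.{u} (Opens.grothendieckTopology Z) (Opens.grothendieckTopology Y)

/-- The adjunction `f⁻¹ ⊣ f_*`. -/
abbrev adj : pull f ⊣ push f := (Opens.map f).sheafAdjunctionContinuous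
  AddCommGrpCat.{u} (Opens.grothendieckTopology Z) (Opens.grothendieckTopology Y)

attribute [local instance] reflectsLimits_of_reflectsIsomorphisms in
lemma preservesFiniteLimits_sheafPullback :
    PreservesFiniteLimits ((Opens.map f).sheafPullback AddCommGrpCat.{u}
      (Opens.grothendieckTopology Z) (Opens.grothendieckTopology Y)) := by
  apply Functor.sheafPullbackConstruction.preservesFiniteLimits

instance : PreservesFiniteLimits (pull f) := preservesFiniteLimits_sheafPullback f

instance : PreservesColimits (pull f) := (adj f).leftAdjoint_preservesColimits

instance : (push f).Additive where

instance : (pull f).Additive := (adj f).left_adjoint_additive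

instance : PreservesFiniteColimits (pull f) := inferInstance

variable (Y) in
/-- The global sections functor `G ↦ G(Y)`. -/
abbrev globalSections : AbSheaf Y ⥤ AddCommGrpCat.{u} :=
  (sheafSections (Opens.grothendieckTopology Y) AddCommGrpCat.{u}).obj (op ⊤)

variable (Y) in
/-- The functor sending an abelian group to the associated constant sheaf on `Y`. -/
abbrev constAb : AddCommGrpCat.{u} ⥤ AbSheaf Y :=
  constantSheaf (Opens.grothendieckTopology Y) AddCommGrpCat.{u}

variable (Y) in
/-- The constant sheaf functor is left adjoint to global sections. -/
def constAdj : constAb Y ⊣ globalSections Y :=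
  constantSheafAdj _ _ (Preorder.isTerminalTop (Opens Y))

variable (Y) in
/-- The constant sheaf `ℤ` on `Y`; by definition `Sheaf.H G n = Ext (constZ Y) G n`, the value at
`G` of the `n`-th right derived functor of `Hom (constZ Y) - = Γ(Y, -)`. -/
abbrev constZ : AbSheaf Y := (constAb Y).obj (AddCommGrpCat.of (ULift.{u} ℤ))

/-- The canonical isomorphism `f⁻¹ M_Z ≅ M_Y` for constant sheaves: the mate of the
identity `Γ(Z, f_* G) = Γ(Y, G)`. -/
def pullConstIso : constAb Z ⋙ pull f ≅ constAb Y :=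
  Adjunction.leftAdjointCompIso (constAdj Z) (adj f) (constAdj Y) (Iso.refl (globalSections Y))

/-- The canonical isomorphism `f⁻¹ g⁻¹ ≅ (g ∘ f)⁻¹`: the mate of the
identity `g_* f_* = (g ∘ f)_*`. -/
def pullCompIso {W : TopCat.{u}} (g : Z ⟶ W) : pull g ⋙ pull f ≅ pull (f ≫ g) :=
  Adjunction.leftAdjointCompIso (adj g) (adj f) (adj (f ≫ g)) (Iso.refl (push (f ≫ g)))

end Functors

section Restriction

variable {X : TopCat.{u}}

/-- A subset `A` of `X` as a topological space, with the subspace topology. -/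
def subspace (A : Set X) : TopCat.{u} := TopCat.of A

/-- The inclusion of a subset `A` of `X`. -/
def incl (A : Set X) : subspace A ⟶ X :=
  TopCat.ofHom ⟨Subtype.val, continuous_subtype_val⟩

/-- The inclusion `A ⟶ B` for subsets `A ⊆ B` of `X`. -/
def inclOf {A B : Set X} (h : A ⊆ B) : subspace A ⟶ subspace B :=
  TopCat.ofHom ⟨Set.inclusion h, continuous_inclusion h⟩

/-- The restriction `F|_A` of a sheaf `F` on `X` to an arbitrary subset `A`, that is, its inverse
image along the inclusion. -/
abbrev restrict (F : AbSheaf X) (A : Set X) : AbSheaf (subspace A) := (pull (incl A)).obj F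

/-- `H^n(A; F) = H^n(A; F|_A)`, sheaf cohomology of the space `A` with coefficients in `F|_A`. -/
abbrev coh (F : AbSheaf X) (n : ℕ) (A : Set X) : Type u := Sheaf.H.{u} (restrict F A) n

/-- The canonical isomorphism `(F|_B)|_A ≅ F|_A` for `A ⊆ B`. -/
def restrictIso (F : AbSheaf X) {A B : Set X} (h : A ⊆ B) :
    (pull (inclOf h)).obj (restrict F B) ≅ restrict F A :=
  (pullCompIso (inclOf h) (incl B)).app F

/-- The canonical isomorphism `ℤ_B|_A ≅ ℤ_A` for `A ⊆ B`. -/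
def constZIso {A B : Set X} (h : A ⊆ B) :
    (pull (inclOf h)).obj (constZ (subspace B)) ≅ constZ (subspace A) :=
  (pullConstIso (inclOf h)).app _

/-- The map `H^n(B; F) → H^n(A; F)` induced in cohomology by the inclusion `A ⊆ B`. It is induced
by the exact functor `(-)|_A` from sheaves on `B` to sheaves on `A`:
`Ext^n(ℤ_B, F|_B) → Ext^n(ℤ_B|_A, (F|_B)|_A) = Ext^n(ℤ_A, F|_A)`. -/
def cohMap (F : AbSheaf X) (n : ℕ) {A B : Set X} (h : A ⊆ B) : coh F n B →+ coh F n A where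
  toFun x := ((Abelian.Ext.mk₀ (constZIso h).inv).comp
    (Abelian.Ext.mapExactFunctor (pull (inclOf h)) x) (zero_add n)).comp
      (Abelian.Ext.mk₀ (restrictIso F h).hom) (add_zero n)
  map_zero' := by simp
  map_add' x y := by simp

/-- The canonical isomorphism `(-|_B)|_A ≅ -|_A` on sheaves on `C`, for `A ⊆ B ⊆ C`. -/
def pullInclIso {A B C : Set X} (h : A ⊆ B) (k : B ⊆ C) :
    pull (inclOf k) ⋙ pull (inclOf h) ≅ pull (inclOf (h.trans k)) :=
  pullCompIso (inclOf h) (inclOf k)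

lemma restrictIso_comp (F : AbSheaf X) {A B C : Set X} (h : A ⊆ B) (k : B ⊆ C) :
    (pull (inclOf h)).map (restrictIso F k).hom ≫ (restrictIso F h).hom =
      (pullInclIso h k).hom.app (restrict F C) ≫
        (restrictIso F (h.trans k)).hom := by
  have := Adjunction.leftAdjointCompIso_assoc (adj (incl C)) (adj (inclOf k)) (adj (inclOf h))
    (adj (incl B)) (adj (inclOf (h.trans k))) (adj (incl A))
    (Iso.refl _) (Iso.refl _) (Iso.refl _) (Iso.refl _) (by ext : 3; rfl)
  have := NatTrans.congr_app (congrArg Iso.hom this) F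
  dsimp at this
  rw [Category.id_comp] at this
  exact this.symm

lemma constZIso_comp {A B C : Set X} (h : A ⊆ B) (k : B ⊆ C) :
    (pull (inclOf h)).map (constZIso k).hom ≫ (constZIso h).hom =
      (pullInclIso h k).hom.app (constZ (subspace C)) ≫
        (constZIso (h.trans k)).hom := by
  have := Adjunction.leftAdjointCompIso_assoc (constAdj (subspace C)) (adj (inclOf k))
    (adj (inclOf h)) (constAdj (subspace B)) (adj (inclOf (h.trans k))) (constAdj (subspace A))
    (Iso.refl _) (Iso.refl _) (Iso.refl _) (Iso.refl _) (by ext : 3; rfl)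
  have := NatTrans.congr_app (congrArg Iso.hom this) (AddCommGrpCat.of (ULift.{u} ℤ))
  dsimp at this
  rw [Category.id_comp] at this
  exact this.symm

lemma cohMap_apply (F : AbSheaf X) (n : ℕ) {A B : Set X} (h : A ⊆ B) (x : coh F n B) :
    cohMap F n h x = ((Abelian.Ext.mk₀ (constZIso h).inv).comp
      (Abelian.Ext.mapExactFunctor (pull (inclOf h)) x) (zero_add n)).comp
        (Abelian.Ext.mk₀ (restrictIso F h).hom) (add_zero n) := rfl

lemma cohMap_comp (F : AbSheaf X) (n : ℕ) {A B C : Set X} (h : A ⊆ B) (k : B ⊆ C)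
    (x : coh F n C) : cohMap F n h (cohMap F n k x) = cohMap F n (h.trans k) x := by
  have e₁ := mapExactFunctor_natTrans _ _ (pullInclIso h k).hom x
  rw [mapExactFunctor_functor_comp] at e₁
  have e₂ : (constZIso (h.trans k)).inv =
      (constZIso h).inv ≫ (pull (inclOf h)).map (constZIso k).inv ≫
        (pullInclIso h k).hom.app (constZ (subspace C)) := by
    rw [← cancel_mono (constZIso (h.trans k)).hom, Iso.inv_hom_id, Category.assoc,
      Category.assoc, ← constZIso_comp h k, ← Functor.map_comp_assoc, Iso.inv_hom_id,
      CategoryTheory.Functor.map_id, Category.id_comp, Iso.inv_hom_id]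
  rw [cohMap_apply, cohMap_apply, cohMap_apply, Abelian.Ext.mapExactFunctor_comp,
    Abelian.Ext.mapExactFunctor_comp, Abelian.Ext.mapExactFunctor_mk₀,
    Abelian.Ext.mapExactFunctor_mk₀, e₂]
  simp only [Abelian.Ext.comp_assoc_of_third_deg_zero, Abelian.Ext.mk₀_comp_mk₀,
    restrictIso_comp F h k]
  rw [← Abelian.Ext.mk₀_comp_mk₀, ← Abelian.Ext.comp_assoc_of_third_deg_zero _ _ _ (add_zero n), e₁]
  simp only [Abelian.Ext.comp_assoc_of_third_deg_zero, Abelian.Ext.mk₀_comp_mk₀_assoc]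

/-- The canonical isomorphism `id⁻¹ ≅ id` for the identity of the space `A`. -/
def pullIdIso (A : Set X) : pull (inclOf (subset_refl A)) ≅ 𝟭 (AbSheaf (subspace A)) :=
  Adjunction.leftAdjointIdIso (adj (inclOf (subset_refl A))) (Iso.refl _)

lemma restrictIso_id (F : AbSheaf X) (A : Set X) :
    (restrictIso F (subset_refl A)).hom = (pullIdIso A).hom.app (restrict F A) := by
  have := Adjunction.leftAdjointCompIso_comp_id (adj (incl A)) (adj (inclOf (subset_refl A)))
    (Iso.refl _) (Iso.refl _) (by ext : 3; rfl)
  have := NatTrans.congr_app (congrArg Iso.hom this) F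
  dsimp at this
  rw [Category.comp_id] at this
  exact this

lemma constZIso_id (A : Set X) :
    (constZIso (subset_refl A)).hom = (pullIdIso A).hom.app (constZ (subspace A)) := by
  have := Adjunction.leftAdjointCompIso_comp_id (constAdj (subspace A))
    (adj (inclOf (subset_refl A))) (Iso.refl _) (Iso.refl _) (by ext : 3; rfl)
  have := NatTrans.congr_app (congrArg Iso.hom this) (AddCommGrpCat.of (ULift.{u} ℤ))
  dsimp at this
  rw [Category.comp_id] at this
  exact this

lemma cohMap_id (F : AbSheaf X) (n : ℕ) (A : Set X) (x : coh F n A) :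
    cohMap F n (subset_refl A) x = x := by
  have e := mapExactFunctor_natTrans _ _ (pullIdIso A).hom x
  rw [mapExactFunctor_id] at e
  rw [cohMap_apply, Abelian.Ext.comp_assoc_of_third_deg_zero, restrictIso_id]
  erw [e]
  rw [← constZIso_id]
  erw [Abelian.Ext.mk₀_comp_mk₀_assoc]
  rw [Iso.inv_hom_id, Abelian.Ext.mk₀_id_comp]

/-- The functor `A ↦ H^n(A; F)` on the poset of subsets of `X`, with the maps induced by the
inclusions. -/
def cohFunctor (F : AbSheaf X) (n : ℕ) : (Set X)ᵒᵖ ⥤ AddCommGrpCat.{u} where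
  obj A := AddCommGrpCat.of (coh F n A.unop)
  map i := AddCommGrpCat.ofHom (cohMap F n (leOfHom i.unop))
  map_id A := by ext x; exact cohMap_id F n A.unop x
  map_comp i j := by ext x; exact (cohMap_comp F n (leOfHom j.unop) (leOfHom i.unop) x).symm

end Restriction

section Tautness

variable {X : TopCat.{u}}

/-- The neighbourhoods of `A` in `X` (not necessarily open), ordered by inclusion. -/
abbrev Nbhd (A : Set X) : Type u := {U : Set X // U ∈ 𝓝ˢ A}

/-- The directed system `U ↦ H^n(U; F)` indexed by the neighbourhoods `U` of `A`, ordered by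
reverse inclusion. -/
def nbhdDiagram (F : AbSheaf X) (n : ℕ) (A : Set X) : (Nbhd A)ᵒᵖ ⥤ AddCommGrpCat.{u} :=
  (Subtype.mono_coe (fun U : Set X => U ∈ 𝓝ˢ A)).functor.op ⋙ cohFunctor F n

/-- The maps `H^n(U; F) → H^n(A; F)`, for `U` a neighbourhood of `A`. -/
def nbhdCocone (F : AbSheaf X) (n : ℕ) (A : Set X) : Cocone (nbhdDiagram F n A) where
  pt := (cohFunctor F n).obj (op A)
  ι :=
    { app := fun U => (cohFunctor F n).map (homOfLE (subset_of_mem_nhdsSet U.unop.2)).op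
      naturality := fun U V i => by
        dsimp [nbhdDiagram]
        rw [Category.comp_id, ← Functor.map_comp]
        rfl }

/-- The canonical map `colim_{U ⊇ A} H^n(U; F) → H^n(A; F)`, the colimit being over all
neighbourhoods `U` of `A` in `X`. -/
def tautMap (F : AbSheaf X) (n : ℕ) (A : Set X) :
    colimit (nbhdDiagram F n A) ⟶ AddCommGrpCat.of (coh F n A) :=
  colimit.desc (nbhdDiagram F n A) (nbhdCocone F n A)

/-- `A` is taut in `X` for the sheaf `F`. -/
def IsTautFor (F : AbSheaf X) (A : Set X) : Prop := ∀ n : ℕ, IsIso (tautMap F n A)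

/-- `A` is taut in `X`. -/
def IsTaut (A : Set X) : Prop := ∀ F : AbSheaf X, IsTautFor F A

/-- `A` has a basis of paracompact normal neighbourhoods in `X`: the neighbourhoods of `A` that
are paracompact and normal as subspaces (neither notion includes the Hausdorff property) form
a basis of the neighbourhoods of `A`. -/
def HasPcNBasis (A : Set X) : Prop :=
  (𝓝ˢ A).HasBasis (fun N : Set X => N ∈ 𝓝ˢ A ∧ ParacompactSpace N ∧ NormalSpace N) id

end Tautness

end

end Taut

/-!
The restriction of a sheaf to a subspace is an exact functor, so every cohomology class on a
neighbourhood can be pulled back, and one has to show that every class on `A` extends to a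
neighbourhood of `A` (`Taut.extends_of_pcNBasis`) and that a class which vanishes on `A` vanishes
on a neighbourhood (`Taut.exists_nhds_pullH_eq_zero`).

Both rest on a vanishing statement (`Taut.exists_open_pullH_eq_zero`): on a paracompact normal
space, every cohomology class with coefficients in a sheaf `K` whose stalks vanish on `A` vanishes
on a neighbourhood of `A`. In degree zero this is clear on any space. In positive degree, a class
`x` is locally trivial. By paracompactness and the shrinking lemma, there is a locally finite closed
cover each of whose members lies in an open set where `x` is trivial. Let `p` be the projection of
the disjoint union of its members. It is closed and its fibres are separated by the members, so
`p_*` is exact although nothing is assumed to be Hausdorff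
(`Taut.preservesFiniteColimits_push`). Consequently `x` dies in the cohomology of `p_* p⁻¹ K`. The
map `K ⟶ p_* p⁻¹ K` is a monomorphism as `p` is surjective, and the stalks of `p_* p⁻¹ K` and of its
quotient by `K` vanish on `A`, because `p` is closed. Thus `x` is the boundary of a class of lower
degree of the same kind.

To extend a class in `H^n(A; F|_A)`, with `i` the inclusion of `A`, embed `i⁻¹F` into an injective
sheaf `J` and consider the adjoint morphism `v : F ⟶ i_* J`. Since `i⁻¹ i_* J ≅ J`, the image of the
class in the cohomology of `im v` is the boundary of a class with coefficients in `coker v`, which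
extends by induction. The kernel of `v` has vanishing stalks on `A`. The obstruction to lifting
the extension from `im v` to `F` therefore vanishes near `A`, on a paracompact normal
neighbourhood (`Taut.Extends.of_map`). In degree zero one takes `J = i⁻¹F`. That a class vanishing
on `A` vanishes near `A` follows by shifting dimensions along an embedding of `F` into an
injective sheaf: the induction uses the extension statement, for the classes of the injective
sheaf itself, whose restrictions to subspaces need not be acyclic.

The maps in cohomology are handled through `Taut.pairH`, which attaches a map
`H^n(Z; G) → H^n(Y; G')` to a continuous map `f : Y ⟶ Z` and a morphism `G ⟶ f_* G'`. In this form
composition is strict (`Taut.pairH_pairH`), because direct images compose strictly.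
-/

namespace Taut

noncomputable section

/-! ### Functoriality of sheaf cohomology in pairs of a map and a morphism of sheaves -/

section Cohomology

open Abelian

variable {X Y Z : TopCat.{u}}

/-- The map `H^n(Z; G) → H^n(Y; f⁻¹G)` induced by a continuous map `f : Y ⟶ Z`. -/
def pullH (f : Y ⟶ Z) {G : AbSheaf Z} {n : ℕ} :
    Sheaf.H.{u} G n →+ Sheaf.H.{u} ((pull f).obj G) n where
  toFun x := (Ext.mk₀ ((pullConstIso f).inv.app _)).comp (x.mapExactFunctor (pull f)) (zero_add n)
  map_zero' := by simp
  map_add' x y := by simp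

lemma pullH_apply (f : Y ⟶ Z) {G : AbSheaf Z} {n : ℕ} (x : Sheaf.H.{u} G n) :
    pullH f x = (Ext.mk₀ ((pullConstIso f).inv.app (AddCommGrpCat.of (ULift.{u} ℤ)))).comp
      (x.mapExactFunctor (pull f)) (zero_add n) := rfl

/-- The map `H^n(Z; G) → H^n(Y; G')` induced by a continuous map `f : Y ⟶ Z` and a morphism of
sheaves `φ : G ⟶ f_* G'`. It is functorial in the pair `(f, φ)`, without any coherence
isomorphism, since `(f ≫ g)_* = g_* f_*` holds by definition. -/
def pairH (f : Y ⟶ Z) {G : AbSheaf Z} {G' : AbSheaf Y} (φ : G ⟶ (push f).obj G') (n : ℕ) :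
    Sheaf.H.{u} G n →+ Sheaf.H.{u} G' n :=
  (Sheaf.H.map (((adj f).homEquiv G G').symm φ) n).comp (pullH f)

lemma pairH_apply (f : Y ⟶ Z) {G : AbSheaf Z} {G' : AbSheaf Y} (φ : G ⟶ (push f).obj G') {n : ℕ}
    (x : Sheaf.H.{u} G n) :
    pairH f φ n x = Sheaf.H.map (((adj f).homEquiv G G').symm φ) n (pullH f x) := rfl

lemma pairH_unit (f : Y ⟶ Z) {G : AbSheaf Z} {n : ℕ} (x : Sheaf.H.{u} G n) :
    pairH f ((adj f).unit.app G) n x = pullH f x := by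
  have : ((adj f).homEquiv G _).symm ((adj f).unit.app G) = 𝟙 _ := by
    rw [Equiv.symm_apply_eq, Adjunction.homEquiv_id]
  exact (congrArg (fun t => Sheaf.H.map t n (pullH f x)) this).trans (Sheaf.H.map_id_apply _)

lemma pullH_map (f : Y ⟶ Z) {G G₁ : AbSheaf Z} (a : G ⟶ G₁) {n : ℕ} (x : Sheaf.H.{u} G n) :
    pullH f (Sheaf.H.map a n x) = Sheaf.H.map ((pull f).map a) n (pullH f x) := by
  rw [pullH_apply, pullH_apply, Sheaf.H.map_apply, Sheaf.H.map_apply, Ext.mapExactFunctor_comp,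
    Ext.mapExactFunctor_mk₀, Ext.comp_assoc_of_third_deg_zero]

lemma pairH_naturality (f : Y ⟶ Z) {G G₁ : AbSheaf Z} {G' G₁' : AbSheaf Y}
    (φ : G ⟶ (push f).obj G') (φ₁ : G₁ ⟶ (push f).obj G₁') (a : G ⟶ G₁) (b : G' ⟶ G₁')
    (w : φ ≫ (push f).map b = a ≫ φ₁) {n : ℕ} (x : Sheaf.H.{u} G n) :
    Sheaf.H.map b n (pairH f φ n x) = pairH f φ₁ n (Sheaf.H.map a n x) := by
  rw [pairH_apply, pairH_apply, pullH_map, ← Sheaf.H.map_comp_apply, ← Sheaf.H.map_comp_apply,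
    ← Adjunction.homEquiv_naturality_right_symm, ← Adjunction.homEquiv_naturality_left_symm, w]

/-- The connecting homomorphism `H^n(Y; S₃) → H^{n+1}(Y; S₁)` of a short exact sequence of
sheaves. -/
def connH {S : ShortComplex (AbSheaf Y)} (hS : S.ShortExact) (n : ℕ) :
    Sheaf.H.{u} S.X₃ n →+ Sheaf.H.{u} S.X₁ (n + 1) :=
  hS.extClass.postcomp _ rfl

lemma connH_apply {S : ShortComplex (AbSheaf Y)} (hS : S.ShortExact) {n : ℕ}
    (x : Sheaf.H.{u} S.X₃ n) : connH hS n x = x.comp hS.extClass rfl := rfl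

/-- The inverse image of a short complex of sheaves. -/
abbrev pullComplex (f : Y ⟶ Z) (S : ShortComplex (AbSheaf Z)) : ShortComplex (AbSheaf Y) :=
  ShortComplex.mk ((pull f).map S.f) ((pull f).map S.g)
    (by rw [← Functor.map_comp, S.zero, Functor.map_zero])

lemma pullComplex_shortExact (f : Y ⟶ Z) {S : ShortComplex (AbSheaf Z)} (hS : S.ShortExact) :
    (pullComplex f S).ShortExact :=
  hS.map_of_exact (pull f)

/-- Exact functors map the extension class of a short exact sequence to that of its image; hence
pullback commutes with connecting homomorphisms. -/
lemma pullH_connH (f : Y ⟶ Z) {S : ShortComplex (AbSheaf Z)} (hS : S.ShortExact) {n : ℕ}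
    (x : Sheaf.H.{u} S.X₃ n) :
    pullH f (connH hS n x) = connH (pullComplex_shortExact f hS) n (pullH f x) := by
  rw [pullH_apply, connH_apply, Ext.mapExactFunctor_comp, Ext.mapExactFunctor_extClass]
  exact (Ext.comp_assoc _ _ _ (zero_add n) _ (by lia)).symm

lemma connH_naturality {S S' : ShortComplex (AbSheaf Y)} (hS : S.ShortExact) (hS' : S'.ShortExact)
    (φ₁ : S.X₁ ⟶ S'.X₁) (φ₂ : S.X₂ ⟶ S'.X₂) (φ₃ : S.X₃ ⟶ S'.X₃)
    (w₁ : φ₁ ≫ S'.f = S.f ≫ φ₂) (w₂ : φ₂ ≫ S'.g = S.g ≫ φ₃) {n : ℕ} (x : Sheaf.H.{u} S.X₃ n) :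
    Sheaf.H.map φ₁ (n + 1) (connH hS n x) = connH hS' n (Sheaf.H.map φ₃ n x) := by
  rw [connH_apply, connH_apply, Sheaf.H.map_apply, Sheaf.H.map_apply,
    Ext.comp_assoc_of_third_deg_zero, Ext.comp_assoc_of_second_deg_zero]
  exact congrArg (fun t => x.comp t rfl)
    (hS.extClass_naturality hS' { τ₁ := φ₁, τ₂ := φ₂, τ₃ := φ₃, comm₁₂ := w₁, comm₂₃ := w₂ })

lemma pairH_connH (f : Y ⟶ Z) {S : ShortComplex (AbSheaf Z)} (hS : S.ShortExact)
    {S' : ShortComplex (AbSheaf Y)} (hS' : S'.ShortExact)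
    (φ₁ : S.X₁ ⟶ (push f).obj S'.X₁) (φ₂ : S.X₂ ⟶ (push f).obj S'.X₂)
    (φ₃ : S.X₃ ⟶ (push f).obj S'.X₃)
    (w₁ : φ₁ ≫ (push f).map S'.f = S.f ≫ φ₂) (w₂ : φ₂ ≫ (push f).map S'.g = S.g ≫ φ₃) {n : ℕ}
    (x : Sheaf.H.{u} S.X₃ n) :
    pairH f φ₁ (n + 1) (connH hS n x) = connH hS' n (pairH f φ₃ n x) := by
  rw [pairH_apply, pairH_apply, pullH_connH]
  refine connH_naturality (pullComplex_shortExact f hS) hS' _ (((adj f).homEquiv _ _).symm φ₂) _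
    ?_ ?_ _
  · rw [← Adjunction.homEquiv_naturality_right_symm, w₁]
    exact Adjunction.homEquiv_naturality_left_symm _ _ _
  · rw [← Adjunction.homEquiv_naturality_right_symm, w₂]
    exact Adjunction.homEquiv_naturality_left_symm _ _ _

/-- Transposition along `F₀₂ ⊣ G₂₀`, compared with iterated transposition along `F₀₁ ⊣ G₁₀` and
`F₁₂ ⊣ G₂₁`, when the left adjoints are identified through an isomorphism `G₂₁ ⋙ G₁₀ ≅ G₂₀`. -/
lemma leftAdjointCompIso_hom_app_comp_homEquiv_symm {C₀ C₁ C₂ : Type*} [Category* C₀]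
    [Category* C₁] [Category* C₂]
    {F₀₁ : C₀ ⥤ C₁} {F₁₂ : C₁ ⥤ C₂} {F₀₂ : C₀ ⥤ C₂}
    {G₁₀ : C₁ ⥤ C₀} {G₂₁ : C₂ ⥤ C₁} {G₂₀ : C₂ ⥤ C₀}
    (adj₀₁ : F₀₁ ⊣ G₁₀) (adj₁₂ : F₁₂ ⊣ G₂₁) (adj₀₂ : F₀₂ ⊣ G₂₀) (e : G₂₁ ⋙ G₁₀ ≅ G₂₀)
    {A : C₀} {B : C₂} (χ : A ⟶ G₂₀.obj B) :
    (Adjunction.leftAdjointCompIso adj₀₁ adj₁₂ adj₀₂ e).hom.app A ≫ (adj₀₂.homEquiv A B).symm χ =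
      (adj₁₂.homEquiv _ _).symm ((adj₀₁.homEquiv _ _).symm (χ ≫ e.inv.app B)) := by
  have h := conjugateEquiv_counit_symm (adj₀₂) (adj₀₁.comp adj₁₂) e.inv B
  rw [Adjunction.leftAdjointCompIso_hom, Adjunction.leftAdjointCompNatTrans]
  simp only [Adjunction.homEquiv_counit, Adjunction.comp_counit_app] at h ⊢
  rw [← NatTrans.naturality_assoc, ← h]
  simp

lemma pullCompIso_hom_app_comp_homEquiv_symm (f : Y ⟶ Z) {W : TopCat.{u}} (g : Z ⟶ W)
    {G : AbSheaf W} {G' : AbSheaf Z} {G'' : AbSheaf Y}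
    (ψ : G ⟶ (push g).obj G') (φ : G' ⟶ (push f).obj G'') :
    (pullCompIso f g).hom.app G ≫ ((adj (f ≫ g)).homEquiv G G'').symm (ψ ≫ (push g).map φ) =
      (pull f).map (((adj g).homEquiv _ _).symm ψ) ≫ ((adj f).homEquiv _ _).symm φ := by
  have h := leftAdjointCompIso_hom_app_comp_homEquiv_symm (adj g) (adj f) (adj (f ≫ g))
    (Iso.refl (push (f ≫ g))) (A := G) (B := G'') (ψ ≫ (push g).map φ)
  refine h.trans ?_
  rw [← Adjunction.homEquiv_naturality_left_symm]
  congr 1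
  erw [Category.comp_id]
  exact Adjunction.homEquiv_naturality_right_symm _ _ _

/-- The isomorphisms `f⁻¹ M ≅ M` for constant sheaves are compatible with
`f⁻¹ g⁻¹ ≅ (f ≫ g)⁻¹`. -/
lemma pullConstIso_comp (f : Y ⟶ Z) {W : TopCat.{u}} (g : Z ⟶ W) (M : AddCommGrpCat.{u}) :
    (pull f).map ((pullConstIso g).hom.app M) ≫ (pullConstIso f).hom.app M =
      (pullCompIso f g).hom.app ((constAb W).obj M) ≫ (pullConstIso (f ≫ g)).hom.app M := by
  have := Adjunction.leftAdjointCompIso_assoc (constAdj W) (adj g)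
    (adj f) (constAdj Z) (adj (f ≫ g)) (constAdj Y)
    (Iso.refl _) (Iso.refl _) (Iso.refl _) (Iso.refl _) (by ext : 3; rfl)
  have := NatTrans.congr_app (congrArg Iso.hom this) M
  dsimp at this
  rw [Category.id_comp] at this
  exact this.symm

/-- Functoriality of `pairH`. The coherence isomorphisms between inverse images are absorbed here
once and for all. -/
lemma pairH_pairH (f : Y ⟶ Z) {W : TopCat.{u}} (g : Z ⟶ W)
    {G : AbSheaf W} {G' : AbSheaf Z} {G'' : AbSheaf Y}
    (ψ : G ⟶ (push g).obj G') (φ : G' ⟶ (push f).obj G'') {n : ℕ} (x : Sheaf.H.{u} G n) :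
    pairH f φ n (pairH g ψ n x) = pairH (f ≫ g) (G' := G'') (ψ ≫ (push g).map φ) n x := by
  have e₁ := mapExactFunctor_natTrans _ _ (pullCompIso f g).hom x
  rw [mapExactFunctor_functor_comp] at e₁
  have e₂ : (pullConstIso (f ≫ g)).inv.app (AddCommGrpCat.of (ULift.{u} ℤ)) =
      (pullConstIso f).inv.app _ ≫ (pull f).map ((pullConstIso g).inv.app _) ≫
        (pullCompIso f g).hom.app _ := by
    rw [← cancel_mono ((pullConstIso (f ≫ g)).hom.app _), Iso.inv_hom_id_app, Category.assoc,
      Category.assoc, ← pullConstIso_comp, ← Functor.map_comp_assoc, Iso.inv_hom_id_app,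
      CategoryTheory.Functor.map_id, Category.id_comp, Iso.inv_hom_id_app]
  rw [pairH_apply, pairH_apply, pairH_apply, pullH_map, ← Sheaf.H.map_comp_apply,
    ← pullCompIso_hom_app_comp_homEquiv_symm, Sheaf.H.map_comp_apply]
  congr 1
  rw [pullH_apply, pullH_apply, pullH_apply, Ext.mapExactFunctor_comp, Ext.mapExactFunctor_mk₀,
    e₂, Sheaf.H.map_apply]
  rw [← Ext.mk₀_comp_mk₀, ← Ext.mk₀_comp_mk₀, Ext.comp_assoc_of_third_deg_zero,
    Ext.comp_assoc_of_third_deg_zero, e₁]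
  simp only [Ext.comp_assoc_of_second_deg_zero]

/-- The identification of `H^0(Y; G)` with the global sections of `G`. -/
def equivSections (G : AbSheaf Y) : Sheaf.H.{u} G 0 ≃+ G.obj.obj (op (⊤ : Opens Y)) :=
  Sheaf.H.equiv₀ G (Preorder.isTerminalTop (Opens Y))

lemma equivSections_map {G G' : AbSheaf Y} (a : G ⟶ G') (x : Sheaf.H.{u} G 0) :
    equivSections G' (Sheaf.H.map a 0 x) = a.hom.app (op ⊤) (equivSections G x) :=
  (Sheaf.H.equiv₀_naturality _ _ _).symm

/-- In terms of the adjunction of constant sheaves and global sections, the map induced by `(f, φ)`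
on morphisms from a constant sheaf is the map `φ` on global sections. -/
lemma pullConstIso_inv_comp (f : Y ⟶ Z) {M : AddCommGrpCat.{u}} {G : AbSheaf Z} {G' : AbSheaf Y}
    (e : (constAb Z).obj M ⟶ G) (φ : G ⟶ (push f).obj G') :
    (constAdj Y).homEquiv _ _ ((pullConstIso f).inv.app M ≫ (pull f).map e ≫
      ((adj f).homEquiv G G').symm φ) =
    (constAdj Z).homEquiv _ _ e ≫ φ.hom.app (op ⊤) := by
  let χ : M ⟶ (globalSections Y).obj G' := (constAdj Z).homEquiv _ _ e ≫ φ.hom.app (op ⊤)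
  suffices h : (pullConstIso f).inv.app M ≫ (pull f).map e ≫ ((adj f).homEquiv G G').symm φ =
      ((constAdj Y).homEquiv _ _).symm χ from (Equiv.eq_symm_apply _).1 h
  rw [← cancel_epi ((pullConstIso f).hom.app M), Iso.hom_inv_id_app_assoc]
  refine Eq.trans ?_ (leftAdjointCompIso_hom_app_comp_homEquiv_symm (constAdj Z) (adj f)
    (constAdj Y) (Iso.refl (globalSections Y)) (A := M) (B := G') χ).symm
  rw [← Adjunction.homEquiv_naturality_left_symm]
  congr 1
  refine (Equiv.eq_symm_apply _).2 (((constAdj Z).homEquiv_naturality_right e φ).trans ?_)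
  exact (Category.comp_id χ).symm

/-- In degree zero `pairH f φ` is the map of global sections `G(Z) → G'(f⁻¹Z) = G'(Y)` given
by `φ`. -/
lemma equivSections_pairH (f : Y ⟶ Z) {G : AbSheaf Z} {G' : AbSheaf Y} (φ : G ⟶ (push f).obj G')
    (x : Sheaf.H.{u} G 0) :
    equivSections G' (pairH f φ 0 x) = φ.hom.app (op ⊤) (equivSections G x) := by
  obtain ⟨e, rfl⟩ := (Ext.mk₀_bijective _ _).2 x
  have h (T : TopCat.{u}) (F : AbSheaf T)
      (e : (constAb T).obj (AddCommGrpCat.of (ULift.{u} ℤ)) ⟶ F) :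
      equivSections F (Ext.mk₀ e) = (constAdj T).homEquiv _ _ e (ULift.up 1) := by
    have : Ext.addEquiv₀ (Ext.mk₀ e) = e :=
      (Ext.mk₀_bijective _ _).1 (Ext.mk₀_addEquiv₀_apply _)
    simp only [equivSections, Sheaf.H.equiv₀, AddEquiv.trans_apply, this]
    rfl
  rw [pairH_apply, pullH_apply, Sheaf.H.map_apply, Ext.mapExactFunctor_mk₀, Ext.mk₀_comp_mk₀,
    Ext.mk₀_comp_mk₀, Category.assoc]
  refine (h _ _ _).trans ?_
  rw [pullConstIso_inv_comp, h]
  rfl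

end Cohomology

/-! ### Sheaves with vanishing stalks, gluing, and local lifting -/

section StalkZero

variable {X Y Z : TopCat.{u}}

/-- The stalk of `G` at `y` vanishes: every section of `G` near `y` vanishes near `y`. -/
def StalkZero (G : AbSheaf Y) (y : Y) : Prop :=
  ∀ (U : Opens Y) (_ : y ∈ U) (s : G.obj.obj (op U)),
    ∃ (V : Opens Y) (h : V ≤ U), y ∈ V ∧ G.obj.map (homOfLE h).op s = 0

open Classical in
/-- The skyscraper sheaf at `y` with value `M`. -/
def sky (y : Y) (M : AddCommGrpCat.{u}) : AbSheaf Y := skyscraperSheaf y M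

lemma stalkZero_iff_isZero_stalk {G : AbSheaf Y} {y : Y} :
    StalkZero G y ↔ IsZero (TopCat.Presheaf.stalk (X := Y) (C := AddCommGrpCat.{u}) G.obj y) := by
  constructor
  · intro h
    have : Subsingleton (TopCat.Presheaf.stalk (X := Y) (C := AddCommGrpCat.{u}) G.obj y) := by
      refine subsingleton_of_forall_eq 0 fun t => ?_
      obtain ⟨U, hU, s, rfl⟩ := TopCat.Presheaf.exists_germ_eq _ t
      obtain ⟨V, hVU, hV, hs⟩ := h U hU s
      rw [← TopCat.Presheaf.germ_res_apply (X := Y) (C := AddCommGrpCat.{u}) G.obj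
        (homOfLE hVU) y hV s, hs, map_zero]
    exact AddCommGrpCat.isZero_of_subsingleton _
  · intro h U hU s
    have := AddCommGrpCat.subsingleton_of_isZero h
    obtain ⟨V, hV, i, j, hs⟩ := TopCat.Presheaf.germ_eq (X := Y) (C := AddCommGrpCat.{u}) G.obj y
      hU hU s 0 (Subsingleton.elim _ _)
    exact ⟨V, i.le, hV, by rw [map_zero] at hs; exact hs⟩

/-- Vanishing of a stalk as a Hom-vanishing condition, by the adjunction of stalks and skyscraper
sheaves. In this form it is visibly compatible with inverse images and epimorphisms. -/
lemma stalkZero_iff_forall_hom_sky {G : AbSheaf Y} {y : Y} :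
    StalkZero G y ↔ ∀ (M : AddCommGrpCat.{u}) (φ : G ⟶ sky y M), φ = 0 := by
  classical
  rw [stalkZero_iff_isZero_stalk]
  let a := stalkSkyscraperSheafAdjunction (C := AddCommGrpCat.{u}) y
  constructor
  · intro h M φ
    apply (a.homEquiv G M).symm.injective
    exact h.eq_of_src _ _
  · intro h
    rw [IsZero.iff_id_eq_zero]
    apply (a.homEquiv G _).injective
    exact (h _ _).trans (h _ _).symm

/-- The stalk of `f⁻¹G` at `y` is that of `G` at `f y`, since `f_*` of the skyscraper sheaf at `y`
is the skyscraper sheaf at `f y`. -/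
lemma stalkZero_pull_iff (f : Y ⟶ Z) {G : AbSheaf Z} {y : Y} :
    StalkZero ((pull f).obj G) y ↔ StalkZero G (f y) := by
  rw [stalkZero_iff_forall_hom_sky, stalkZero_iff_forall_hom_sky]
  have e (M : AddCommGrpCat.{u}) : (push f).obj (sky y M) = sky (f y) M := rfl
  constructor
  · intro h M φ
    apply ((adj f).homEquiv G (sky y M)).symm.injective
    exact (h _ _).trans (h _ _).symm
  · intro h M φ
    apply ((adj f).homEquiv G (sky y M)).injective
    exact (h M _).trans (h M _).symm

lemma StalkZero.of_epi {G G' : AbSheaf Y} {y : Y} (h : StalkZero G y) (p : G ⟶ G') [Epi p] :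
    StalkZero G' y := by
  rw [stalkZero_iff_forall_hom_sky] at h ⊢
  intro M φ
  rw [← cancel_epi p, h M (p ≫ φ), comp_zero]

lemma stalkZero_of_isZero {G : AbSheaf Y} (h : IsZero G) (y : Y) : StalkZero G y :=
  stalkZero_iff_forall_hom_sky.2 fun _ _ => h.eq_of_src _ _

lemma stalkZero_of_isZero_pull (f : Y ⟶ Z) {G : AbSheaf Z} (h : IsZero ((pull f).obj G)) (y : Y) :
    StalkZero G (f y) :=
  (stalkZero_pull_iff f).1 (stalkZero_of_isZero h y)

lemma section_eq_zero_of_locally (G : AbSheaf Y) {U : Opens Y} (s : G.obj.obj (op U))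
    (h : ∀ y ∈ U, ∃ (V : Opens Y) (i : V ≤ U), y ∈ V ∧ G.obj.map (homOfLE i).op s = 0) : s = 0 := by
  choose V i hV hs using h
  refine TopCat.Sheaf.eq_of_locally_eq' G (fun y : U => V y.1 y.2) U
    (fun y => homOfLE (i y.1 y.2)) (fun y hy => Opens.mem_iSup.2 ⟨⟨y, hy⟩, hV y hy⟩) s 0
    fun y => ?_
  rw [map_zero]
  exact hs y.1 y.2

lemma isZero_of_stalkZero {G : AbSheaf Y} (h : ∀ y, StalkZero G y) : IsZero G := by
  have h' (U : Opens Y) (s : G.obj.obj (op U)) : s = 0 :=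
    section_eq_zero_of_locally G s fun y hy => h y U hy s
  rw [IsZero.iff_id_eq_zero]
  apply Sheaf.hom_ext
  ext U s
  exact h' U.unop s

/-- Sections over pairwise disjoint open sets glue. -/
lemma exists_glue_of_disjoint (G : AbSheaf Y) {J : Type*} (W : J → Opens Y)
    (hW : ∀ j k, ∀ y ∈ W j, y ∈ W k → j = k) (s : ∀ j, G.obj.obj (op (W j))) :
    ∃ t : G.obj.obj (op (⨆ j, W j)), ∀ j, G.obj.map (homOfLE (le_iSup W j)).op t = s j := by
  obtain ⟨t, ht, -⟩ := TopCat.Sheaf.existsUnique_gluing G W s fun j k => by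
    by_cases hjk : j = k
    · subst hjk; rfl
    · refine (sub_eq_zero.1 (section_eq_zero_of_locally G _ fun y hy => ?_))
      exact (hjk (hW j k y hy.1 hy.2)).elim
  exact ⟨t, ht⟩

lemma eq_of_eq_on_iSup (G : AbSheaf Y) {J : Type*} (W : J → Opens Y)
    (s t : G.obj.obj (op (⨆ j, W j)))
    (h : ∀ j, G.obj.map (homOfLE (le_iSup W j)).op s = G.obj.map (homOfLE (le_iSup W j)).op t) :
    s = t :=
  TopCat.Sheaf.eq_of_locally_eq G W s t h

/-- If the stalks of `G` vanish on `A`, a section of `G` vanishes on a neighbourhood of `A`. -/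
lemma exists_open_section_eq_zero (G : AbSheaf Y) {A : Set Y} (hA : ∀ a ∈ A, StalkZero G a)
    {U : Opens Y} (hAU : A ⊆ U) (s : G.obj.obj (op U)) :
    ∃ (V : Opens Y) (h : V ≤ U), A ⊆ V ∧ G.obj.map (homOfLE h).op s = 0 := by
  choose V i hV hs using fun a : A => hA a.1 a.2 U (hAU a.2) s
  refine ⟨⨆ a, V a, iSup_le i, fun a ha => Opens.mem_iSup.2 ⟨⟨a, ha⟩, hV _⟩, ?_⟩
  refine eq_of_eq_on_iSup G V _ _ fun a => ?_
  rw [← ConcreteCategory.comp_apply, ← Functor.map_comp, map_zero]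
  exact hs a

/-- Epimorphisms of sheaves are the morphisms along which sections lift locally. -/
lemma epi_iff_locally_lifts {G G' : AbSheaf Y} (p : G ⟶ G') :
    Epi p ↔ ∀ (U : Opens Y) (t : G'.obj.obj (op U)), ∀ y ∈ U,
      ∃ (V : Opens Y) (h : V ≤ U) (s : G.obj.obj (op V)), y ∈ V ∧
        p.hom.app (op V) s = G'.obj.map (homOfLE h).op t := by
  rw [← Sheaf.isLocallySurjective_iff_epi']
  refine (TopCat.Presheaf.isLocallySurjective_iff p.hom).trans ?_
  constructor
  · intro h U t y hy
    obtain ⟨V, i, ⟨s, hs⟩, hV⟩ := h U t y hy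
    exact ⟨V, i, s, hV, hs⟩
  · intro h U t y hy
    obtain ⟨V, i, s, hV, hs⟩ := h U t y hy
    exact ⟨V, i, ⟨s, hs⟩, hV⟩

end StalkZero

/-! ### Exactness of the direct image along a closed cover -/

section ClosedMap

variable {X Y Z : TopCat.{u}}

lemma map_map_apply (G : AbSheaf Y) {U V W : Opens Y} (h : V ≤ U) (k : W ≤ V)
    (s : G.obj.obj (op U)) :
    G.obj.map (homOfLE k).op (G.obj.map (homOfLE h).op s) =
      G.obj.map (homOfLE (k.trans h)).op s := by
  rw [← ConcreteCategory.comp_apply, ← Functor.map_comp]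
  rfl

lemma app_map_apply {G G' : AbSheaf Y} (φ : G ⟶ G') {U V : Opens Y} (h : V ≤ U)
    (s : G.obj.obj (op U)) :
    φ.hom.app (op V) (G.obj.map (homOfLE h).op s) =
      G'.obj.map (homOfLE h).op (φ.hom.app (op U) s) :=
  ConcreteCategory.congr_hom (φ.hom.naturality (homOfLE h).op) s

/-- For a closed map, a neighbourhood of a fibre contains the preimage of a neighbourhood of the
point. -/
lemma exists_open_map_le_of_isClosedMap {p : Y ⟶ X} (hp : IsClosedMap p) {a : X} {O : Opens Y}
    (hO : ∀ y, p y = a → y ∈ O) : ∃ V : Opens X, a ∈ V ∧ (Opens.map p).obj V ≤ O := by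
  refine ⟨⟨(p '' (O : Set Y)ᶜ)ᶜ, (hp _ O.isOpen.isClosed_compl).isOpen_compl⟩, ?_, ?_⟩
  · rintro ⟨y, hy, rfl⟩
    exact hy (hO y rfl)
  · intro y hy
    by_contra h
    exact hy ⟨y, h, rfl⟩

lemma stalkZero_push_of_isClosedMap {p : Y ⟶ X} (hp : IsClosedMap p) {G : AbSheaf Y} {a : X}
    (h : ∀ y, p y = a → StalkZero G y) : StalkZero ((push p).obj G) a := by
  refine fun U ha (s : G.obj.obj (op ((Opens.map p).obj U))) => ?_
  obtain ⟨O, hO, haO, hs⟩ := exists_open_section_eq_zero G (A := p ⁻¹' {a}) h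
    (U := (Opens.map p).obj U) (by rintro y rfl; exact ha) s
  obtain ⟨V, haV, hV⟩ := exists_open_map_le_of_isClosedMap hp (O := O) fun y hy => haO hy
  refine ⟨V ⊓ U, inf_le_right, ⟨haV, ha⟩, ?_⟩
  have h₁ : (Opens.map p).obj (V ⊓ U) ≤ O := fun y hy => hV hy.1
  have := congrArg (G.obj.map (homOfLE h₁).op) hs
  rw [map_map_apply, map_zero] at this
  exact this

/-- The direct image along a closed map `p` is exact if the points of each fibre of `p` are
separated by a locally constant function `c`: local lifts near the points of a fibre then glue to
a lift near the whole fibre, hence over the preimage of a neighbourhood. -/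
lemma preservesFiniteColimits_push {p : Y ⟶ X} (hp : IsClosedMap p) {J : Type*} {c : Y → J}
    (hc : IsLocallyConstant c) (hpc : ∀ y y', p y = p y' → c y = c y' → y = y') :
    PreservesFiniteColimits (push p) := by
  refine (Functor.preservesFiniteColimits_iff_forall_exact_map_and_epi _).2 fun S hS => ⟨?_, ?_⟩
  · have := hS.mono_f
    exact (hS.exact.map_of_mono_of_preservesKernel _ inferInstance inferInstance)
  have := hS.epi_g
  have hg := (epi_iff_locally_lifts S.g).1 inferInstance
  refine (epi_iff_locally_lifts _).2 fun U
    (t : S.X₃.obj.obj (op ((Opens.map p).obj U))) a ha => ?_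
  choose V hVU s hV hs using fun y : {y // p y = a} =>
    hg ((Opens.map p).obj U) t y.1 (by rw [← y.2] at ha; exact ha)
  -- Cut the domains of the local lifts down to the pieces of `c`, so that they become disjoint.
  let W : {y // p y = a} → Opens Y := fun y => V y ⊓ ⟨c ⁻¹' {c y.1}, hc.isOpen_fiber _⟩
  have hWV y : W y ≤ V y := inf_le_left
  obtain ⟨r, hr⟩ := exists_glue_of_disjoint S.X₂ W
    (fun j k y hj hk => Subtype.ext (hpc _ _ (j.2.trans k.2.symm) (hj.2.symm.trans hk.2)))
    (fun y => S.X₂.obj.map (homOfLE (hWV y)).op (s y))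
  have hWU : ⨆ y, W y ≤ (Opens.map p).obj U := iSup_le fun y => (hWV y).trans (hVU y)
  have hrt : S.g.hom.app _ r = S.X₃.obj.map (homOfLE hWU).op t := by
    refine eq_of_eq_on_iSup S.X₃ W _ _ fun y => ?_
    rw [← app_map_apply, hr, app_map_apply, hs, map_map_apply, map_map_apply]
  obtain ⟨O, haO, hO⟩ := exists_open_map_le_of_isClosedMap hp (O := ⨆ y, W y) (a := a)
    fun y hy => Opens.mem_iSup.2 ⟨⟨y, hy⟩, hV _, rfl⟩
  have h₁ : (Opens.map p).obj (O ⊓ U) ≤ ⨆ y, W y := fun y hy => hO hy.1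
  refine ⟨O ⊓ U, inf_le_right, S.X₂.obj.map (homOfLE h₁).op r, ⟨haO, ha⟩, ?_⟩
  have := congrArg (S.X₃.obj.map (homOfLE h₁).op) hrt
  rw [map_map_apply, ← app_map_apply] at this
  exact this

/-- A paracompact normal space `X` has, for every choice of neighbourhoods `V a` of its points, a
closed surjection `p` from a disjoint union of closed sets subordinate to the family `V`; the
function `c` names the piece to which a point belongs. -/
lemma exists_closed_cover [ParacompactSpace X] [NormalSpace X] (V : X → Opens X)
    (hV : ∀ a, a ∈ V a) :
    ∃ (Y : TopCat.{u}) (p : Y ⟶ X) (c : Y → X), IsClosedMap p ∧ Function.Surjective p ∧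
      IsLocallyConstant c ∧ (∀ y y', p y = p y' → c y = c y' → y = y') ∧ ∀ y, p y ∈ V (c y) := by
  obtain ⟨v, hvo, hvc, hvf, hvV⟩ := precise_refinement (fun a => (V a : Set X))
    (fun a => (V a).isOpen) (Set.iUnion_eq_univ_iff.2 fun a => ⟨a, hV a⟩)
  -- The shrinking lemma for normal spaces turns the open refinement into a closed one.
  obtain ⟨D, hDc, hD, hDv⟩ := exists_iUnion_eq_closed_subset hvo hvf.point_finite hvc
  have hDf : LocallyFinite D := hvf.subset hDv
  refine ⟨TopCat.of (Σ a, D a), TopCat.ofHom ⟨fun y => y.2.1, ?_⟩, Sigma.fst, ?_, ?_, ?_, ?_, ?_⟩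
  · exact continuous_sigma fun a => continuous_subtype_val
  · intro C hC
    have : (fun y : Σ a, D a => y.2.1) '' C =
        ⋃ a, (Subtype.val '' ((fun y : D a => (⟨a, y⟩ : Σ a, D a)) ⁻¹' C)) := by
      ext x
      simp only [Set.mem_image, Set.mem_iUnion, Set.mem_preimage]
      constructor
      · rintro ⟨⟨a, y⟩, hy, rfl⟩
        exact ⟨a, y, hy, rfl⟩
      · rintro ⟨a, y, hy, rfl⟩
        exact ⟨⟨a, y⟩, hy, rfl⟩
    refine (congrArg IsClosed this).mpr (LocallyFinite.isClosed_iUnion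
      (hDf.subset fun a => ?_) fun a => ?_)
    · rintro _ ⟨y, -, rfl⟩
      exact y.2
    · exact (hD a).isClosedEmbedding_subtypeVal.isClosedMap _
        (hC.preimage continuous_sigmaMk)
  · intro x
    obtain ⟨a, ha⟩ := Set.mem_iUnion.1 (hDc.symm ▸ Set.mem_univ x : x ∈ ⋃ a, D a)
    exact ⟨⟨a, x, ha⟩, rfl⟩
  · rw [IsLocallyConstant.iff_isOpen_fiber]
    intro a
    have : (Sigma.fst ⁻¹' {a} : Set (Σ a, D a)) = Set.range (Sigma.mk a) := by
      ext y
      constructor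
      · rintro rfl; exact ⟨y.2, rfl⟩
      · rintro ⟨y, rfl⟩; rfl
    exact (congrArg IsOpen this).mpr isOpen_range_sigmaMk
  · rintro ⟨a, y⟩ ⟨a', y'⟩ (h : y.1 = y'.1) (rfl : a = a')
    rw [Subtype.ext h]
  · rintro ⟨a, y⟩
    exact hvV a (hDv a y.2)

end ClosedMap

/-! ### Vanishing of cohomology near a set on which the stalks vanish -/

section Vanishing

open Abelian

variable {X Y Z : TopCat.{u}}

lemma connH_map_g {S : ShortComplex (AbSheaf Y)} (hS : S.ShortExact) {n : ℕ}
    (x : Sheaf.H.{u} S.X₂ n) : connH hS n (Sheaf.H.map S.g n x) = 0 := by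
  rw [connH_apply, Sheaf.H.map_apply, Ext.comp_assoc_of_second_deg_zero, hS.comp_extClass,
    Ext.comp_zero]

lemma exists_connH_eq {S : ShortComplex (AbSheaf Y)} (hS : S.ShortExact) {n : ℕ}
    (x : Sheaf.H.{u} S.X₁ (n + 1)) (hx : Sheaf.H.map S.f (n + 1) x = 0) :
    ∃ y : Sheaf.H.{u} S.X₃ n, connH hS n y = x :=
  Ext.covariant_sequence_exact₁ _ hS x hx rfl

lemma exists_map_f_eq {S : ShortComplex (AbSheaf Y)} (hS : S.ShortExact) {n : ℕ}
    (x : Sheaf.H.{u} S.X₂ n) (hx : Sheaf.H.map S.g n x = 0) :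
    ∃ y : Sheaf.H.{u} S.X₁ n, Sheaf.H.map S.f n y = x :=
  Ext.covariant_sequence_exact₂ _ hS x hx

lemma exists_map_g_eq {S : ShortComplex (AbSheaf Y)} (hS : S.ShortExact) {n : ℕ}
    (x : Sheaf.H.{u} S.X₃ n) (hx : connH hS n x = 0) :
    ∃ y : Sheaf.H.{u} S.X₂ n, Sheaf.H.map S.g n y = x :=
  Ext.covariant_sequence_exact₃ _ hS x rfl hx

/-- The short exact sequence `0 → G → J → J/G → 0` of a monomorphism. -/
abbrev cokernelComplex {G J : AbSheaf Y} (i : G ⟶ J) : ShortComplex (AbSheaf Y) :=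
  ShortComplex.mk i (cokernel.π i) (cokernel.condition i)

lemma cokernelComplex_shortExact {G J : AbSheaf Y} (i : G ⟶ J) [Mono i] :
    (cokernelComplex i).ShortExact where
  exact := ShortComplex.exact_of_g_is_cokernel _ (cokernelIsCokernel _)

lemma map_injective_eq_zero {G J : AbSheaf Y} [Injective J] (i : G ⟶ J) {n : ℕ}
    (x : Sheaf.H.{u} G (n + 1)) : Sheaf.H.map i (n + 1) x = 0 :=
  Ext.eq_zero_of_injective _

lemma pullH_connH_eq_zero (f : Y ⟶ Z) {S : ShortComplex (AbSheaf Z)} (hS : S.ShortExact) {n : ℕ}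
    {x : Sheaf.H.{u} S.X₃ n} (hx : pullH f x = 0) : pullH f (connH hS n x) = 0 := by
  rw [pullH_connH, hx, map_zero]

/-- The pullback of sections `G(U) → (f⁻¹G)(f⁻¹U)`. -/
def pullSection (f : Y ⟶ Z) (G : AbSheaf Z) (U : Opens Z) :
    G.obj.obj (op U) →+ ((pull f).obj G).obj.obj (op ((Opens.map f).obj U)) :=
  (((adj f).unit.app G).hom.app (op U)).hom

lemma pullSection_map (f : Y ⟶ Z) (G : AbSheaf Z) {U V : Opens Z} (h : V ≤ U)
    (s : G.obj.obj (op U)) :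
    pullSection f G V (G.obj.map (homOfLE h).op s) =
      ((pull f).obj G).obj.map (homOfLE ((Opens.map f).monotone h)).op (pullSection f G U s) :=
  app_map_apply ((adj f).unit.app G) h s

lemma map_app_pullSection (f : Y ⟶ Z) {G G' : AbSheaf Z} (φ : G ⟶ G') {U : Opens Z}
    (s : G.obj.obj (op U)) :
    ((pull f).map φ).hom.app (op ((Opens.map f).obj U)) (pullSection f G U s) =
      pullSection f G' U (φ.hom.app (op U) s) :=
  (ConcreteCategory.congr_hom (NatTrans.congr_app (congrArg (·.hom) ((adj f).unit.naturality φ))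
    (op U)) s).symm

lemma equivSections_pullH (f : Y ⟶ Z) {G : AbSheaf Z} (x : Sheaf.H.{u} G 0) :
    equivSections ((pull f).obj G) (pullH f x) = pullSection f G ⊤ (equivSections G x) := by
  rw [← pairH_unit]
  exact equivSections_pairH f ((adj f).unit.app G) x

lemma pullSection_map_top (f : Y ⟶ Z) {G : AbSheaf Z} (x : Sheaf.H.{u} G 0) (U : Opens Z) :
    pullSection f G U (G.obj.map (homOfLE le_top).op (equivSections G x)) =
      ((pull f).obj G).obj.map (homOfLE le_top).op (equivSections _ (pullH f x)) := by
  rw [pullSection_map, equivSections_pullH]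
  rfl

lemma map_self_apply (G : AbSheaf Y) {U : Opens Y} (h : U ≤ U) (s : G.obj.obj (op U)) :
    G.obj.map (homOfLE h).op s = s :=
  ConcreteCategory.congr_hom (G.obj.map_id (op U)) s

/-- A section which lifts locally along `π` lifts globally after pullback to a space
whose pieces are mapped into the open sets where a lift exists. -/
lemma exists_map_eq_pullH_of_lifts {G G' : AbSheaf Z} (π : G ⟶ G') (x : Sheaf.H.{u} G' 0)
    {J : Type*} (V : J → Opens Z) (s : ∀ j, G.obj.obj (op (V j)))
    (hs : ∀ j, π.hom.app _ (s j) = G'.obj.map (homOfLE le_top).op (equivSections G' x))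
    (q : Y ⟶ Z) {c : Y → J} (hc : IsLocallyConstant c) (hq : ∀ y, q y ∈ V (c y)) :
    ∃ z : Sheaf.H.{u} ((pull q).obj G) 0, Sheaf.H.map ((pull q).map π) 0 z = pullH q x := by
  let W : J → Opens Y := fun j => ⟨c ⁻¹' {j}, hc.isOpen_fiber _⟩
  have hW (j) : W j ≤ (Opens.map q).obj (V j) := by
    rintro y rfl
    exact hq y
  obtain ⟨t, ht⟩ := exists_glue_of_disjoint ((pull q).obj G) W (by rintro j k y rfl rfl; rfl)
    fun j => ((pull q).obj G).obj.map (homOfLE (hW j)).op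
      (pullSection q G (V j) (s j))
  have htop : (⊤ : Opens Y) ≤ ⨆ j, W j := fun y _ => Opens.mem_iSup.2 ⟨c y, rfl⟩
  have key : ((pull q).map π).hom.app _ t = ((pull q).obj G').obj.map (homOfLE le_top).op
      (equivSections _ (pullH q x)) := by
    refine eq_of_eq_on_iSup _ W _ _ fun j => ?_
    rw [← app_map_apply, ht, app_map_apply, map_app_pullSection, hs, pullSection_map_top,
      map_map_apply, map_map_apply]
  refine ⟨(equivSections _).symm (((pull q).obj G).obj.map (homOfLE htop).op t), ?_⟩
  apply (equivSections _).injective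
  rw [equivSections_map, AddEquiv.apply_symm_apply, app_map_apply, key, map_map_apply,
    map_self_apply]

/-- Cohomology classes of positive degree vanish locally, in the form: they are killed by the
pullback to a space whose pieces are mapped into small open sets. -/
lemma exists_cover_pullH_eq_zero {n : ℕ} {G : AbSheaf X} (x : Sheaf.H.{u} G (n + 1)) :
    ∃ V : X → Opens X, (∀ a, a ∈ V a) ∧ ∀ (Y : TopCat.{u}) (q : Y ⟶ X) (c : Y → X),
      IsLocallyConstant c → (∀ y, q y ∈ V (c y)) → pullH q x = 0 := by
  induction n generalizing G with
  | zero =>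
    have hS := cokernelComplex_shortExact (Injective.ι G)
    obtain ⟨y, rfl⟩ := exists_connH_eq hS x (map_injective_eq_zero _ _)
    -- `x` is the boundary of a section `y`, which lifts locally to the injective sheaf.
    have hg := (epi_iff_locally_lifts (cokernelComplex (Injective.ι G)).g).1 inferInstance
    choose V _ s hV hs using fun a : X => hg ⊤ (equivSections _ y) a trivial
    refine ⟨V, hV, fun Y q c hc hq => ?_⟩
    obtain ⟨z, hz⟩ := exists_map_eq_pullH_of_lifts _ y V s hs q hc hq
    refine (pullH_connH q hS y).trans ?_
    rw [← hz]
    exact connH_map_g (pullComplex_shortExact q hS) z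
  | succ n ih =>
    have hS := cokernelComplex_shortExact (Injective.ι G)
    obtain ⟨y, rfl⟩ := exists_connH_eq hS x (map_injective_eq_zero _ _)
    obtain ⟨V, hV, h⟩ := ih y
    refine ⟨V, hV, fun Y q c hc hq => ?_⟩
    exact pullH_connH_eq_zero q hS (h Y q c hc hq)

lemma mapExactFunctor_eq_zero_of_pullH_eq_zero (p : Y ⟶ X) {G : AbSheaf X} {n : ℕ}
    {x : Sheaf.H.{u} G n} (hx : pullH p x = 0) : x.mapExactFunctor (pull p) = 0 := by
  have := congrArg (fun t => (Ext.mk₀ ((pullConstIso p).hom.app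
    (AddCommGrpCat.of (ULift.{u} ℤ)))).comp t (zero_add n)) hx
  simpa only [pullH_apply, Ext.mk₀_comp_mk₀_assoc, Iso.hom_inv_id_app, Ext.mk₀_id_comp,
    Ext.comp_zero] using this

/-- If `p_*` is exact, a class killed by the pullback along `p` is killed by the unit
`G ⟶ p_* p⁻¹ G`. -/
lemma map_unit_eq_zero_of_pullH_eq_zero (p : Y ⟶ X) [PreservesFiniteColimits (push p)]
    {G : AbSheaf X} {n : ℕ} {x : Sheaf.H.{u} G n} (hx : pullH p x = 0) :
    Sheaf.H.map ((adj p).unit.app G) n x = 0 := by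
  -- Naturality of the unit `𝟭 ⟶ p⁻¹ ⋙ p_*` between exact functors: the image of `x` in
  -- `H^n(X; p_* p⁻¹ G)` is obtained by applying `p⁻¹` and then `p_*` to `x`.
  have h := mapExactFunctor_natTrans _ _ (adj p).unit x
  rw [mapExactFunctor_id, mapExactFunctor_functor_comp,
    mapExactFunctor_eq_zero_of_pullH_eq_zero p hx, Ext.mapExactFunctor_zero, Ext.comp_zero] at h
  exact h

lemma isZero_pull_kernel (i : A ⟶ X) {F P : AbSheaf X} (v : F ⟶ P) [Mono ((pull i).map v)] :
    IsZero ((pull i).obj (kernel v)) := by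
  have h : (pull i).map (kernel.ι v) = 0 := by
    rw [← cancel_mono ((pull i).map v), ← Functor.map_comp, kernel.condition,
      Functor.map_zero, zero_comp]
  rw [IsZero.iff_id_eq_zero, ← cancel_mono ((pull i).map (kernel.ι v)), h]
  simp

/-- If `p` is surjective, then `G` embeds into `p_* p⁻¹ G`. -/
lemma mono_unit_of_surjective {p : Y ⟶ X} (hp : Function.Surjective p) (G : AbSheaf X) :
    Mono ((adj p).unit.app G) := by
  rw [Preadditive.mono_iff_isZero_kernel]
  refine isZero_of_stalkZero fun x => ?_
  obtain ⟨y, rfl⟩ := hp x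
  refine stalkZero_of_isZero_pull p ?_ y
  -- By the triangle identity, the unit becomes a split monomorphism after applying `p⁻¹`.
  have : Mono ((pull p).map ((adj p).unit.app G)) := by
    have := (adj p).left_triangle_components G
    have : Mono ((pull p).map ((adj p).unit.app G) ≫ (adj p).counit.app ((pull p).obj G)) := by
      rw [this]; exact inferInstanceAs (Mono (𝟙 ((pull p).obj G)))
    exact mono_of_mono _ ((adj p).counit.app ((pull p).obj G))
  exact isZero_pull_kernel p _

/-- On any space, a section of a sheaf whose stalks vanish on `A` vanishes near `A`. -/
lemma exists_open_pullH_eq_zero_of_degree_zero {A : Set X} {K : AbSheaf X}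
    (hK : ∀ a ∈ A, StalkZero K a) (x : Sheaf.H.{u} K 0) :
    ∃ U : Opens X, A ⊆ U ∧ ∀ (Y : TopCat.{u}) (f : Y ⟶ X), (∀ y, f y ∈ U) → pullH f x = 0 := by
  obtain ⟨U, _, hAU, hU⟩ := exists_open_section_eq_zero K hK (U := ⊤) (fun _ _ => trivial)
    (equivSections K x)
  refine ⟨U, hAU, fun Y f hf => ?_⟩
  apply (equivSections _).injective
  have h := pullSection_map_top f x U
  rw [hU, map_zero] at h
  have htop : (⊤ : Opens Y) ≤ (Opens.map f).obj U := fun y _ => hf y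
  have := congrArg (((pull f).obj K).obj.map (homOfLE htop).op) h
  rw [map_map_apply, map_zero, map_self_apply] at this
  rw [map_zero, this]

/-- On a paracompact normal space, a cohomology class with coefficients in a sheaf whose stalks
vanish on `A` vanishes on a neighbourhood of `A`. In positive degree the class is killed by the
embedding `K ⟶ p_* p⁻¹ K`, for `p` the projection of a fine enough closed cover; the stalks of
`p_* p⁻¹ K` and of the cokernel vanish on `A` as well. -/
lemma exists_open_pullH_eq_zero [ParacompactSpace X] [NormalSpace X] {A : Set X} {n : ℕ}
    {K : AbSheaf X} (hK : ∀ a ∈ A, StalkZero K a) (x : Sheaf.H.{u} K n) :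
    ∃ U : Opens X, A ⊆ U ∧ ∀ (Y : TopCat.{u}) (f : Y ⟶ X), (∀ y, f y ∈ U) → pullH f x = 0 := by
  induction n generalizing K with
  | zero => exact exists_open_pullH_eq_zero_of_degree_zero hK x
  | succ n ih =>
    obtain ⟨V, hV, h⟩ := exists_cover_pullH_eq_zero x
    obtain ⟨Y, p, c, hp, hps, hc, hpc, hpV⟩ := exists_closed_cover V hV
    have := preservesFiniteColimits_push hp hc hpc
    have := mono_unit_of_surjective hps K
    have hS := cokernelComplex_shortExact ((adj p).unit.app K)
    obtain ⟨y, rfl⟩ := exists_connH_eq hS x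
      (map_unit_eq_zero_of_pullH_eq_zero p (h Y p c hc hpV))
    obtain ⟨U, hAU, hU⟩ := ih (K := (cokernelComplex ((adj p).unit.app K)).X₃) (fun a ha =>
      StalkZero.of_epi (stalkZero_push_of_isClosedMap hp fun y hy =>
        (stalkZero_pull_iff p).2 (hy ▸ hK a ha)) (cokernel.π _)) y
    refine ⟨U, hAU, fun Y f hf => ?_⟩
    exact pullH_connH_eq_zero f hS (hU Y f hf)

end Vanishing

/-! ### Inducing maps: the direct image is fully faithful -/

section Embedding

variable {A X Y Z : TopCat.{u}}

/-- The largest open set whose preimage is contained in `V`. -/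
def extendOpens (i : A ⟶ X) (V : Opens A) : Opens X := sSup {U | (Opens.map i).obj U ≤ V}

lemma extendOpens_mono (i : A ⟶ X) {V W : Opens A} (h : V ≤ W) :
    extendOpens i V ≤ extendOpens i W :=
  sSup_le_sSup fun _ hU => le_trans hU h

lemma le_extendOpens (i : A ⟶ X) (U : Opens X) : U ≤ extendOpens i ((Opens.map i).obj U) :=
  le_sSup (le_refl ((Opens.map i).obj U))

lemma map_extendOpens_le (i : A ⟶ X) (V : Opens A) : (Opens.map i).obj (extendOpens i V) ≤ V := by
  intro a ha
  obtain ⟨U, hU, haU⟩ := Opens.mem_sSup.1 (show i a ∈ sSup {U | (Opens.map i).obj U ≤ V} from ha)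
  exact hU haU

lemma le_map_extendOpens {i : A ⟶ X} (hi : IsInducing i) (V : Opens A) :
    V ≤ (Opens.map i).obj (extendOpens i V) := by
  obtain ⟨U, hU, hUV⟩ := hi.isOpen_iff.1 V.isOpen
  intro a ha
  have hle : (Opens.map i).obj ⟨U, hU⟩ ≤ V := fun b hb =>
    (Set.ext_iff.1 hUV b).1 hb
  exact Opens.mem_sSup.2 ⟨⟨U, hU⟩, hle, (Set.ext_iff.1 hUV a).2 ha⟩

lemma faithful_push {i : A ⟶ X} (hi : IsInducing i) : (push i).Faithful where
  map_injective {G G'} α β h := by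
    apply Sheaf.hom_ext
    ext V s
    have e : V.unop = (Opens.map i).obj (extendOpens i V.unop) :=
      le_antisymm (le_map_extendOpens hi _) (map_extendOpens_le i _)
    obtain ⟨V⟩ := V
    change V = _ at e
    revert s
    rw [e]
    intro s
    exact ConcreteCategory.congr_hom (NatTrans.congr_app (congrArg (·.hom) h)
      (op (extendOpens i V))) s

/-- A morphism `γ : i_* G ⟶ i_* G'` comes from a morphism `G ⟶ G'`, since every open set of `A` is
the preimage of an open set of `X`: on `V` take the component of `γ` at `extendOpens i V`. -/
lemma full_push {i : A ⟶ X} (hi : IsInducing i) : (push i).Full where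
  map_surjective {G G'} γ := by
    let c (U : Opens X) : G.obj.obj (op ((Opens.map i).obj U)) ⟶
      G'.obj.obj (op ((Opens.map i).obj U)) := γ.hom.app (op U)
    have hc {U V : Opens X} (h : V ≤ U) :
        G.obj.map (homOfLE ((Opens.map i).monotone h)).op ≫ c V =
          c U ≫ G'.obj.map (homOfLE ((Opens.map i).monotone h)).op :=
      γ.hom.naturality (homOfLE h).op
    have hF (F : AbSheaf A) {U V W : Opens A} (h : V ≤ U) (k : W ≤ V) :
        F.obj.map (homOfLE h).op ≫ F.obj.map (homOfLE k).op =
          F.obj.map (homOfLE (k.trans h)).op := by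
      rw [← Functor.map_comp]; rfl
    let b (V : Opens A) : G.obj.obj (op V) ⟶ G'.obj.obj (op V) :=
      G.obj.map (homOfLE (map_extendOpens_le i V)).op ≫ c (extendOpens i V) ≫
        G'.obj.map (homOfLE (le_map_extendOpens hi V)).op
    have hb {V W : Opens A} (h : W ≤ V) :
        G.obj.map (homOfLE h).op ≫ b W = b V ≫ G'.obj.map (homOfLE h).op := by
      simp only [b, Category.assoc]
      rw [reassoc_of% (hF G h (map_extendOpens_le i W)), hF,
        ← reassoc_of% (hF G (map_extendOpens_le i V)
          ((Opens.map i).monotone (extendOpens_mono i h))),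
        reassoc_of% (hc (extendOpens_mono i h)), hF]
    let β : G ⟶ G' := ⟨{ app := fun V => b V.unop, naturality := fun V W f => hb (leOfHom f.unop) }⟩
    refine ⟨β, ?_⟩
    apply Sheaf.hom_ext
    ext U : 2
    obtain ⟨U⟩ := U
    change b ((Opens.map i).obj U) = c U
    simp only [b]
    rw [← hc (le_extendOpens i U), ← Category.assoc, hF]
    exact (congrArg (· ≫ c U) (G.obj.map_id _)).trans (Category.id_comp _)

/-- For an inducing map `i`, the counit `i⁻¹ i_* G ⟶ G` is an isomorphism. -/
lemma isIso_counit {i : A ⟶ X} (hi : IsInducing i) (G : AbSheaf A) :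
    IsIso ((adj i).counit.app G) := by
  have := faithful_push hi
  have := full_push hi
  infer_instance

end Embedding

/-! ### Restriction maps and neighbourhoods -/

section Restriction

open Abelian

variable {A B C X Y : TopCat.{u}}

/-- For maps `g : A ⟶ B` and `f : B ⟶ X` with composite `i`, the morphism `f⁻¹F ⟶ g_* i⁻¹F` which
is adjoint to the unit `F ⟶ i_* i⁻¹F = f_* g_* i⁻¹F`. It induces the restriction map
`H^n(B; f⁻¹F) → H^n(A; i⁻¹F)`. -/
def restr {g : A ⟶ B} {f : B ⟶ X} {i : A ⟶ X} (w : g ≫ f = i) (F : AbSheaf X) :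
    (pull f).obj F ⟶ (push g).obj ((pull i).obj F) :=
  ((adj f).homEquiv F ((push g).obj ((pull i).obj F))).symm
    ((adj i).unit.app F ≫ eqToHom (by subst w; rfl))

lemma homEquiv_restr (g : A ⟶ B) (f : B ⟶ X) (F : AbSheaf X) :
    (adj f).homEquiv F ((push g).obj ((pull (g ≫ f)).obj F)) (restr rfl F) =
      (adj (g ≫ f)).unit.app F := by
  refine (Equiv.apply_symm_apply _ _).trans ?_
  exact Category.comp_id _

lemma restr_naturality {g : A ⟶ B} {f : B ⟶ X} {i : A ⟶ X} (w : g ≫ f = i) {F F' : AbSheaf X}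
    (a : F ⟶ F') :
    restr w F ≫ (push g).map ((pull i).map a) = (pull f).map a ≫ restr w F' := by
  subst w
  apply ((adj f).homEquiv _ _).injective
  refine ((adj f).homEquiv_naturality_right _ _).trans ?_
  refine Eq.trans ?_ ((adj f).homEquiv_naturality_left _ _).symm
  rw [homEquiv_restr, homEquiv_restr]
  exact ((adj (g ≫ f)).unit.naturality a).symm

/-- The restriction map `H^n(B; f⁻¹F) → H^n(A; i⁻¹F)` for `g : A ⟶ B`, `f : B ⟶ X` with
composite `i`. -/
def restrH {g : A ⟶ B} {f : B ⟶ X} {i : A ⟶ X} (w : g ≫ f = i) (F : AbSheaf X) (n : ℕ) :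
    Sheaf.H.{u} ((pull f).obj F) n →+ Sheaf.H.{u} ((pull i).obj F) n :=
  pairH g (restr w F) n

lemma restrH_map {g : A ⟶ B} {f : B ⟶ X} {i : A ⟶ X} (w : g ≫ f = i) {F F' : AbSheaf X}
    (a : F ⟶ F') {n : ℕ} (x : Sheaf.H.{u} ((pull f).obj F) n) :
    restrH w F' n (Sheaf.H.map ((pull f).map a) n x) =
      Sheaf.H.map ((pull i).map a) n (restrH w F n x) :=
  (pairH_naturality g _ _ _ _ (restr_naturality w a) x).symm

lemma restrH_connH {g : A ⟶ B} {f : B ⟶ X} {i : A ⟶ X} (w : g ≫ f = i)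
    {S : ShortComplex (AbSheaf X)} (hS : S.ShortExact) {n : ℕ}
    (x : Sheaf.H.{u} ((pull f).obj S.X₃) n) :
    restrH w S.X₁ (n + 1) (connH (pullComplex_shortExact f hS) n x) =
      connH (pullComplex_shortExact i hS) n (restrH w S.X₃ n x) :=
  pairH_connH g (pullComplex_shortExact f hS) (pullComplex_shortExact i hS) (restr w S.X₁)
    (restr w S.X₂) (restr w S.X₃) (restr_naturality w S.f) (restr_naturality w S.g) x

lemma restrH_pullH {g : A ⟶ B} {f : B ⟶ X} {i : A ⟶ X} (w : g ≫ f = i) (F : AbSheaf X) {n : ℕ}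
    (x : Sheaf.H.{u} F n) : restrH w F n (pullH f x) = pullH i x := by
  subst w
  rw [← pairH_unit f x, ← pairH_unit (g ≫ f) x, restrH]
  refine (pairH_pairH g f _ _ _).trans ?_
  congr 1
  congr 1
  exact ((adj f).homEquiv_unit _ _ _).symm.trans (homEquiv_restr g f F)

lemma restrH_restrH {h : A ⟶ B} {g : B ⟶ C} {f : C ⟶ X} {j : A ⟶ C} {k : B ⟶ X} {i : A ⟶ X}
    (w₁ : h ≫ k = i) (w₂ : g ≫ f = k) (w₃ : h ≫ g = j) (w₄ : j ≫ f = i) (F : AbSheaf X) {n : ℕ}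
    (x : Sheaf.H.{u} ((pull f).obj F) n) :
    restrH w₁ F n (restrH w₂ F n x) = restrH w₄ F n x := by
  subst w₂ w₃ w₁
  refine (pairH_pairH h g _ _ _).trans ?_
  unfold restrH
  congr 1
  congr 1
  apply ((adj f).homEquiv _ _).injective
  refine ((adj f).homEquiv_naturality_right _ _).trans ?_
  rw [homEquiv_restr]
  refine Eq.trans ?_ (homEquiv_restr (h ≫ g) f F).symm
  exact ((adj (g ≫ f)).homEquiv_unit _ _ _).symm.trans (homEquiv_restr h (g ≫ f) F)

/-- The transpose of `restr` is the canonical isomorphism `g⁻¹ f⁻¹ F ≅ (g ≫ f)⁻¹ F`. -/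
lemma pullCompIso_hom_app_eq (g : A ⟶ B) (f : B ⟶ X) (F : AbSheaf X) :
    (pullCompIso g f).hom.app F = ((adj g).homEquiv _ _).symm (restr rfl F) := by
  have h := pullCompIso_hom_app_comp_homEquiv_symm g f ((adj f).unit.app F) (restr rfl F)
  have e₁ : (adj f).unit.app F ≫ (push f).map (restr (rfl : g ≫ f = g ≫ f) F) =
      (adj (g ≫ f)).unit.app F :=
    ((adj f).homEquiv_unit _ _ _).symm.trans (homEquiv_restr g f F)
  have e₂ {Y Z : TopCat.{u}} (q : Y ⟶ Z) (G : AbSheaf Z) :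
      ((adj q).homEquiv G _).symm ((adj q).unit.app G) = 𝟙 _ := by
    rw [Equiv.symm_apply_eq, Adjunction.homEquiv_id]
  have h₁ := (congrArg (fun t => (pullCompIso g f).hom.app F ≫
    ((adj (g ≫ f)).homEquiv F _).symm t) e₁).symm.trans h
  refine Eq.trans ?_ (h₁.trans ?_)
  · exact (Category.comp_id _).symm.trans
      (congrArg ((pullCompIso g f).hom.app F ≫ ·) (e₂ (g ≫ f) F).symm)
  · refine (congrArg (fun t => (pull g).map t ≫ ((adj g).homEquiv _ _).symm (restr rfl F))
      (e₂ f F)).trans ?_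
    rw [CategoryTheory.Functor.map_id]
    exact Category.id_comp _

lemma map_isIso_injective {G G' : AbSheaf Y} (φ : G ⟶ G') [IsIso φ] (n : ℕ) :
    Function.Injective (Sheaf.H.map.{u} φ n) := by
  intro x y h
  have := congrArg (Sheaf.H.map.{u} (inv φ) n) h
  rw [← Sheaf.H.map_comp_apply, ← Sheaf.H.map_comp_apply, IsIso.hom_inv_id,
    Sheaf.H.map_id_apply, Sheaf.H.map_id_apply] at this
  exact this

/-- Restriction to `A` differs from pullback to `A` by the isomorphism `g⁻¹ f⁻¹ F ≅ i⁻¹ F`. -/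
lemma restrH_eq_zero_iff {g : A ⟶ B} {f : B ⟶ X} {i : A ⟶ X} (w : g ≫ f = i) (F : AbSheaf X)
    {n : ℕ} (x : Sheaf.H.{u} ((pull f).obj F) n) : restrH w F n x = 0 ↔ pullH g x = 0 := by
  subst w
  rw [restrH, pairH_apply, ← pullCompIso_hom_app_eq]
  exact (map_eq_zero_iff _ (map_isIso_injective _ n))

end Restriction

section Neighbourhoods

variable {A X Y : TopCat.{u}}

/-- A map `i : A ⟶ X`, seen as a map to a subset `B` of `X` which contains its image. -/
def toSub (i : A ⟶ X) (B : Set X) (h : ∀ a, i a ∈ B) : A ⟶ subspace B :=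
  TopCat.ofHom ⟨fun a => ⟨i a, h a⟩, i.hom.continuous.subtype_mk h⟩

lemma toSub_incl (i : A ⟶ X) (B : Set X) (h : ∀ a, i a ∈ B) : toSub i B h ≫ incl B = i := rfl

lemma inclOf_incl {B C : Set X} (h : B ⊆ C) : inclOf h ≫ incl C = incl B := rfl

lemma toSub_inclOf (i : A ⟶ X) {B C : Set X} (h : B ⊆ C) (hB : ∀ a, i a ∈ B) :
    toSub i B hB ≫ inclOf h = toSub i C fun a => h (hB a) := rfl

/-- `i` identifies `A` with a subspace of `X` (up to inseparable points of `A`) whose paracompact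
normal neighbourhoods form a neighbourhood basis. -/
structure PcNBasis (i : A ⟶ X) : Prop where
  isInducing : IsInducing i
  exists_subset : ∀ U ∈ 𝓝ˢ (Set.range i), ∃ N ∈ 𝓝ˢ (Set.range i), N ⊆ U ∧
    ParacompactSpace N ∧ NormalSpace N

lemma mem_of_mem_nhdsSet_range {i : A ⟶ X} {B : Set X} (hB : B ∈ 𝓝ˢ (Set.range i)) (a : A) :
    i a ∈ B :=
  subset_of_mem_nhdsSet hB ⟨a, rfl⟩

lemma image_mem_nhdsSet_range {i : A ⟶ X} {B : Set X} (hB : B ∈ 𝓝ˢ (Set.range i))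
    {V : Set (subspace B)}
    (hV : V ∈ 𝓝ˢ (Set.range (toSub i B (mem_of_mem_nhdsSet_range hB)))) :
    Subtype.val '' V ∈ 𝓝ˢ (Set.range i) := by
  rw [mem_nhdsSet_iff_forall] at hV ⊢
  rintro _ ⟨a, rfl⟩
  have h₁ : B ∈ 𝓝 (i a) := mem_nhdsSet_iff_forall.1 hB _ ⟨a, rfl⟩
  have h₂ := hV _ ⟨a, rfl⟩
  have h₃ := map_nhds_subtype_coe_eq_nhds (p := (· ∈ B)) (mem_of_mem_nhds h₁) h₁
  rw [← h₃]
  exact Filter.image_mem_map h₂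

/-- A basis of paracompact normal neighbourhoods is inherited by any neighbourhood. -/
lemma PcNBasis.toSub {i : A ⟶ X} (hi : PcNBasis i) {B : Set X} (hB : B ∈ 𝓝ˢ (Set.range i)) :
    PcNBasis (toSub i B (mem_of_mem_nhdsSet_range hB)) where
  isInducing := by
    have : IsInducing ((Subtype.val : B → X) ∘ Taut.toSub i B (mem_of_mem_nhdsSet_range hB)) :=
      hi.isInducing
    exact IsInducing.of_comp (Taut.toSub i B (mem_of_mem_nhdsSet_range hB)).hom.continuous
      continuous_subtype_val this
  exists_subset U hU := by
    obtain ⟨N, hN, hNU, hN₁, hN₂⟩ := hi.exists_subset _ (image_mem_nhdsSet_range hB hU)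
    have hNB : N ⊆ Set.range (Subtype.val : B → X) := by
      intro x hx
      obtain ⟨y, -, rfl⟩ := hNU hx
      exact ⟨y, rfl⟩
    let e : ((Subtype.val : B → X) ⁻¹' N) ≃ₜ N := IsEmbedding.subtypeVal.homeomorphOfSubsetRange hNB
    refine ⟨Subtype.val ⁻¹' N, ?_, ?_, e.isClosedEmbedding.paracompactSpace, e.symm.normalSpace⟩
    · rw [mem_nhdsSet_iff_forall] at hN ⊢
      rintro _ ⟨a, rfl⟩
      exact continuous_subtype_val.continuousAt.preimage_mem_nhds (hN _ ⟨a, rfl⟩)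
    · intro x hx
      obtain ⟨y, hy, hyx⟩ := hNU hx
      exact Subtype.ext hyx ▸ hy

/-- The class `x` is the restriction of a class on a neighbourhood of the image of `i`. -/
def Extends (i : A ⟶ X) (F : AbSheaf X) {n : ℕ} (x : Sheaf.H.{u} ((pull i).obj F) n) : Prop :=
  ∃ (B : Set X) (hB : B ∈ 𝓝ˢ (Set.range i)) (y : Sheaf.H.{u} ((pull (incl B)).obj F) n),
    restrH (toSub_incl i B (mem_of_mem_nhdsSet_range hB)) F n y = x

end Neighbourhoods

/-! ### Extension of classes to neighbourhoods, and tautness -/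

section Tautness

open Abelian

variable {A X Y : TopCat.{u}}

/-- Extension of classes along an epimorphism `F ⟶ F''` whose kernel has vanishing stalks on `A`:
the obstruction to lifting an extension from `F''` to `F` lies in the cohomology of the kernel,
hence vanishes on a smaller neighbourhood. -/
lemma Extends.of_map {i : A ⟶ X} (hi : PcNBasis i) {S : ShortComplex (AbSheaf X)}
    (hS : S.ShortExact) (hK : IsZero ((pull i).obj S.X₁)) {n : ℕ}
    (x : Sheaf.H.{u} ((pull i).obj S.X₂) n)
    (hx : Extends i S.X₃ (Sheaf.H.map ((pull i).map S.g) n x)) : Extends i S.X₂ x := by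
  obtain ⟨B, hB, y, hy⟩ := hx
  obtain ⟨N, hN, hNB, hN₁, hN₂⟩ := hi.exists_subset B hB
  have : ParacompactSpace (subspace N) := hN₁
  have : NormalSpace (subspace N) := hN₂
  let hiN := mem_of_mem_nhdsSet_range hN
  let y₁ := restrH (inclOf_incl hNB) S.X₃ n y
  have hy₁ : restrH (toSub_incl i N hiN) S.X₃ n y₁ = Sheaf.H.map ((pull i).map S.g) n x :=
    (restrH_restrH _ _ (toSub_inclOf i hNB hiN) _ _ y).trans hy
  -- The obstruction to lifting `y₁` is its boundary, with coefficients in the kernel.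
  obtain ⟨U, hU, hUy⟩ := exists_open_pullH_eq_zero (X := subspace N)
    (A := Set.range (toSub i N hiN)) (K := (pull (incl N)).obj S.X₁)
    (by
      rintro _ ⟨a, rfl⟩
      exact (stalkZero_pull_iff (incl N)).2 (stalkZero_of_isZero_pull i hK a))
    (connH (pullComplex_shortExact (incl N) hS) n y₁)
  have hB' : Subtype.val '' (U : Set (subspace N)) ∈ 𝓝ˢ (Set.range i) :=
    image_mem_nhdsSet_range hN (U.isOpen.mem_nhdsSet.2 hU)
  have hBN : Subtype.val '' (U : Set (subspace N)) ⊆ N := by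
    rintro _ ⟨b, -, rfl⟩
    exact b.2
  have hob := hUy _ (inclOf hBN) fun b => by
    obtain ⟨c, hc, hcb⟩ := b.2
    have e : c = inclOf hBN b := Subtype.ext hcb
    exact e ▸ hc
  have hob' := (restrH_eq_zero_iff (inclOf_incl hBN) S.X₁ _).2 hob
  rw [restrH_connH _ hS] at hob'
  obtain ⟨z, hz⟩ := exists_map_g_eq _ _ hob'
  refine ⟨_, hB', z, ?_⟩
  -- The lift `z` restricts to `x`, since `i⁻¹F ⟶ i⁻¹F''` is an isomorphism.
  have : IsIso ((pull i).map S.g) :=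
    (pullComplex_shortExact i hS).isIso_g_iff.2 hK
  apply map_isIso_injective ((pull i).map S.g) n
  rw [← restrH_map, ← hy₁]
  refine (congrArg _ hz).trans ?_
  exact restrH_restrH _ _ (toSub_inclOf i hBN (mem_of_mem_nhdsSet_range hB')) _ _ y₁

/-- Let `i⁻¹v` be a monomorphism, for a morphism `v : F ⟶ P` of sheaves. To extend a class with
coefficients in `F` it is enough to extend its image in the cohomology of the (co)image of `v`. -/
lemma Extends.of_map_coimage {i : A ⟶ X} (hi : PcNBasis i) {F P : AbSheaf X} (v : F ⟶ P)
    [Mono ((pull i).map v)] {n : ℕ} (x : Sheaf.H.{u} ((pull i).obj F) n)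
    (hx : Extends i (Abelian.coimage v)
      (Sheaf.H.map ((pull i).map (Abelian.coimage.π v)) n x)) : Extends i F x :=
  Extends.of_map hi (cokernelComplex_shortExact (kernel.ι v)) (isZero_pull_kernel i v) x hx

lemma map_homEquiv_comp_counit {i : A ⟶ X} (F : AbSheaf X) {J : AbSheaf A}
    (m : (pull i).obj F ⟶ J) :
    (pull i).map ((adj i).homEquiv F J m) ≫ (adj i).counit.app J = m :=
  ((adj i).homEquiv_counit _ _ _).symm.trans (Equiv.symm_apply_apply _ _)

lemma mono_map_homEquiv {i : A ⟶ X} (F : AbSheaf X) {J : AbSheaf A} (m : (pull i).obj F ⟶ J)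
    [Mono m] : Mono ((pull i).map ((adj i).homEquiv F J m)) := by
  have : Mono ((pull i).map ((adj i).homEquiv F J m) ≫ (adj i).counit.app J) := by
    rw [map_homEquiv_comp_counit]; infer_instance
  exact mono_of_mono _ ((adj i).counit.app J)

/-- Every section of `G` is a section of `i_* G`. -/
lemma exists_map_counit_pullH_eq (i : A ⟶ X) {G : AbSheaf A} (x : Sheaf.H.{u} G 0) :
    ∃ p : Sheaf.H.{u} ((push i).obj G) 0,
      Sheaf.H.map ((adj i).counit.app G) 0 (pullH i p) = x := by
  have e : ((adj i).homEquiv ((push i).obj G) G).symm (𝟙 ((push i).obj G)) =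
      (adj i).counit.app G := by
    rw [(adj i).homEquiv_counit, CategoryTheory.Functor.map_id, Category.id_comp]
  let s : ((push i).obj G).obj.obj (op ⊤) := equivSections G x
  refine ⟨(equivSections ((push i).obj G)).symm s, ?_⟩
  rw [← e]
  refine (pairH_apply i (G' := G) (𝟙 ((push i).obj G)) _).symm.trans ?_
  apply (equivSections G).injective
  rw [equivSections_pairH, AddEquiv.apply_symm_apply]
  rfl

/-- Classes of degree zero extend. With `P = i_* i⁻¹F`, a section of `i⁻¹F` is a global section of
`P`; its image in the cokernel `Q` of `F ⟶ P` vanishes near `A`, since `i⁻¹Q = 0`. So it lies in the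
image of `F ⟶ P` near `A`, and `Extends.of_map_coimage` applies. -/
lemma extends_of_degree_zero {i : A ⟶ X} (hi : PcNBasis i) (F : AbSheaf X)
    (x : Sheaf.H.{u} ((pull i).obj F) 0) : Extends i F x := by
  let v := (adj i).homEquiv F _ (𝟙 ((pull i).obj F))
  have hv : (pull i).map v ≫ (adj i).counit.app _ = 𝟙 ((pull i).obj F) :=
    map_homEquiv_comp_counit F _
  have := isIso_counit hi.isInducing ((pull i).obj F)
  have hviso : IsIso ((pull i).map v) := by
    have : IsIso ((pull i).map v ≫ (adj i).counit.app ((pull i).obj F)) := by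
      rw [hv]; infer_instance
    exact IsIso.of_isIso_comp_right _ ((adj i).counit.app ((pull i).obj F))
  apply Extends.of_map_coimage hi v
  have hS := cokernelComplex_shortExact (Abelian.factorThruCoimage v)
  have hfac : (pull i).map (Abelian.coimage.π v) ≫ (pull i).map (Abelian.factorThruCoimage v) =
      (pull i).map v := by
    rw [← Functor.map_comp, Abelian.coimage.fac]
  have hmiso : IsIso ((pull i).map (Abelian.factorThruCoimage v)) := by
    have : Epi ((pull i).map (Abelian.coimage.π v) ≫
        (pull i).map (Abelian.factorThruCoimage v)) := by
      rw [hfac]; infer_instance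
    have := epi_of_epi ((pull i).map (Abelian.coimage.π v))
      ((pull i).map (Abelian.factorThruCoimage v))
    exact isIso_of_mono_of_epi _
  have hQ : IsZero ((pull i).obj (cokernel (Abelian.factorThruCoimage v))) :=
    (pullComplex_shortExact i hS).isIso_f_iff.1 hmiso
  obtain ⟨p, hp'⟩ := exists_map_counit_pullH_eq i x
  have hp : pullH i p = Sheaf.H.map ((pull i).map v) 0 x := by
    apply map_isIso_injective ((adj i).counit.app ((pull i).obj F)) 0
    rw [hp', ← Sheaf.H.map_comp_apply]
    exact (Sheaf.H.map_id_apply x).symm.trans (congrArg (fun t => Sheaf.H.map t 0 x) hv).symm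
  obtain ⟨U, hU, hUp⟩ := exists_open_pullH_eq_zero_of_degree_zero (A := Set.range i)
    (K := cokernel (Abelian.factorThruCoimage v))
    (by rintro _ ⟨a, rfl⟩; exact stalkZero_of_isZero_pull i hQ a)
    (Sheaf.H.map (cokernel.π (Abelian.factorThruCoimage v)) 0 p)
  have hUn : (U : Set X) ∈ 𝓝ˢ (Set.range i) := U.isOpen.mem_nhdsSet.2 hU
  have h := hUp _ (incl (U : Set X)) fun b => b.2
  rw [pullH_map] at h
  obtain ⟨y, hy⟩ := exists_map_f_eq (pullComplex_shortExact (incl (U : Set X)) hS) _ h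
  refine ⟨_, hUn, y, ?_⟩
  apply map_isIso_injective ((pull i).map (Abelian.factorThruCoimage v)) 0
  rw [← restrH_map, ← Sheaf.H.map_comp_apply, hfac, ← hp]
  exact (congrArg _ hy).trans (restrH_pullH _ _ _)

/-- Every cohomology class on `A` extends to a neighbourhood. In positive degree embed `i⁻¹F` into
an injective sheaf `J` and let `v : F ⟶ i_* J` be the adjoint morphism. Since `i⁻¹ i_* J ≅ J` has no
cohomology, the image of the class in the cohomology of `im v` is a boundary, hence extends by
induction. -/
lemma extends_of_pcNBasis {i : A ⟶ X} (hi : PcNBasis i) (n : ℕ) (F : AbSheaf X)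
    (x : Sheaf.H.{u} ((pull i).obj F) n) : Extends i F x := by
  induction n generalizing F with
  | zero => exact extends_of_degree_zero hi F x
  | succ n ih =>
    let J := Injective.under ((pull i).obj F)
    let v := (adj i).homEquiv F J (Injective.ι ((pull i).obj F))
    have : Mono ((pull i).map v) := mono_map_homEquiv F _
    apply Extends.of_map_coimage hi v
    have hS := cokernelComplex_shortExact (Abelian.factorThruCoimage v)
    have := isIso_counit hi.isInducing J
    have : Injective ((pull i).obj ((push i).obj J)) :=
      Injective.of_iso (asIso ((adj i).counit.app J)).symm inferInstance
    obtain ⟨y, hy⟩ := exists_connH_eq (pullComplex_shortExact i hS)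
      (Sheaf.H.map ((pull i).map (Abelian.coimage.π v)) (n + 1) x) (map_injective_eq_zero _ _)
    obtain ⟨B, hB, z, hz⟩ := ih _ y
    refine ⟨B, hB, connH (pullComplex_shortExact (incl B) hS) n z, ?_⟩
    refine (restrH_connH _ hS z).trans ?_
    rw [← hy, ← hz]

/-- A class which vanishes on `A` vanishes on a neighbourhood of `A`. A class of positive degree is
the boundary of a class `y` with coefficients in a quotient `Q` of an injective sheaf `I`. On `A`
the class `y` lifts to the cohomology of `I`. The lift extends to a neighbourhood, and the
difference between `y` and the image of this extension vanishes on `A`, hence near `A` by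
induction. -/
lemma exists_nhds_pullH_eq_zero (n : ℕ) {i : A ⟶ X} (hi : PcNBasis i) (F : AbSheaf X)
    (x : Sheaf.H.{u} F n) (hx : pullH i x = 0) :
    ∃ B ∈ 𝓝ˢ (Set.range i), ∀ (Y : TopCat.{u}) (f : Y ⟶ X), (∀ y, f y ∈ B) → pullH f x = 0 := by
  induction n generalizing X with
  | zero =>
    -- `x` is a morphism `e` from the constant sheaf, and the inverse image of its image is zero.
    obtain ⟨e, rfl⟩ := (Ext.mk₀_bijective _ _).2 x
    have he : (pull i).map e = 0 := by
      have := mapExactFunctor_eq_zero_of_pullH_eq_zero i hx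
      rwa [Ext.mapExactFunctor_mk₀, Ext.mk₀_eq_zero_iff] at this
    have hz : (pull i).map (Abelian.coimage.π e) = 0 := by
      rw [← cancel_mono ((pull i).map (Abelian.factorThruCoimage e)), ← Functor.map_comp,
        Abelian.coimage.fac, he, zero_comp]
    have hE : IsZero ((pull i).obj (Abelian.coimage e)) := by
      rw [IsZero.iff_id_eq_zero, ← cancel_epi ((pull i).map (Abelian.coimage.π e)), hz]
      simp
    obtain ⟨U, hU, hUe⟩ := exists_open_pullH_eq_zero_of_degree_zero (A := Set.range i)
      (K := Abelian.coimage e) (by rintro _ ⟨a, rfl⟩; exact stalkZero_of_isZero_pull i hE a)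
      (Ext.mk₀ (Abelian.coimage.π e))
    refine ⟨U, U.isOpen.mem_nhdsSet.2 hU, fun Y f hf => ?_⟩
    have : (Ext.mk₀ e : Sheaf.H.{u} F 0) =
        Sheaf.H.map (Abelian.factorThruCoimage e) 0 (Ext.mk₀ (Abelian.coimage.π e)) := by
      rw [Sheaf.H.map_apply, Ext.mk₀_comp_mk₀, Abelian.coimage.fac]
    rw [this, pullH_map]
    exact (congrArg _ (hUe Y f hf)).trans (map_zero _)
  | succ n ih =>
    have hS := cokernelComplex_shortExact (Injective.ι F)
    obtain ⟨y, rfl⟩ := exists_connH_eq hS x (map_injective_eq_zero _ _)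
    obtain ⟨z, hz⟩ := exists_map_g_eq (pullComplex_shortExact i hS) (pullH i y)
      ((pullH_connH i hS y).symm.trans hx)
    obtain ⟨B, hB, z', rfl⟩ := extends_of_pcNBasis hi n _ z
    let hiB := mem_of_mem_nhdsSet_range hB
    let t := Sheaf.H.map ((pull (incl B)).map (cokernel.π (Injective.ι F))) n z'
    have ht : pullH (toSub i B hiB) (pullH (incl B) y - t) = 0 := by
      rw [← restrH_eq_zero_iff (toSub_incl i B hiB), map_sub, restrH_pullH, sub_eq_zero]
      exact hz.symm.trans (restrH_map _ _ _).symm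
    obtain ⟨V, hV, hVw⟩ := ih (hi.toSub hB) _ _ ht
    refine ⟨_, image_mem_nhdsSet_range hB hV, fun Y f hf => ?_⟩
    have hfB (y : Y) : f y ∈ B := by
      obtain ⟨b, -, hb⟩ := hf y
      exact hb ▸ b.2
    have h := hVw _ (toSub f B hfB) fun y => by
      obtain ⟨b, hb, hby⟩ := hf y
      exact (Subtype.ext hby : b = toSub f B hfB y) ▸ hb
    rw [← restrH_eq_zero_iff (toSub_incl f B hfB), map_sub, restrH_pullH, sub_eq_zero] at h
    refine (pullH_connH f hS y).trans ?_
    rw [h]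
    refine (congrArg (connH (pullComplex_shortExact f hS) n) (restrH_map _ _ _)).trans ?_
    exact connH_map_g (pullComplex_shortExact f hS) _

/-- The map induced by an inclusion of subsets is a restriction map in the sense of `restrH`. -/
lemma cohMap_eq_restrH (F : AbSheaf X) (n : ℕ) {A B : Set X} (h : A ⊆ B) (x : coh F n B) :
    cohMap F n h x = restrH (inclOf_incl h) F n x := by
  rw [restrH, pairH_apply]
  exact congrArg (fun t => Sheaf.H.map t n (pullH (inclOf h) x))
    (pullCompIso_hom_app_eq (inclOf h) (incl B) F)

lemma range_incl (A : Set X) : Set.range (incl A) = A := Subtype.range_coe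

lemma HasPcNBasis.pcNBasis {A : Set X} (hA : HasPcNBasis A) : PcNBasis (incl A) where
  isInducing := IsInducing.subtypeVal
  exists_subset U hU := by
    rw [range_incl] at hU ⊢
    obtain ⟨N, ⟨hN, h₁, h₂⟩, hNU⟩ := hA.mem_iff.1 hU
    exact ⟨N, hN, hNU, h₁, h₂⟩

lemma exists_cohMap_eq {A : Set X} (hA : HasPcNBasis A) (F : AbSheaf X) (n : ℕ) (x : coh F n A) :
    ∃ (U : Nbhd A) (y : coh F n U.1), cohMap F n (subset_of_mem_nhdsSet U.2) y = x := by
  obtain ⟨B, hB, y, hy⟩ := extends_of_pcNBasis hA.pcNBasis n F x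
  rw [range_incl] at hB
  refine ⟨⟨B, hB⟩, y, ?_⟩
  rw [cohMap_eq_restrH]
  exact hy

lemma exists_cohMap_eq_zero {A : Set X} (hA : HasPcNBasis A) (F : AbSheaf X) (n : ℕ) (U : Nbhd A)
    (x : coh F n U.1) (hx : cohMap F n (subset_of_mem_nhdsSet U.2) x = 0) :
    ∃ (V : Nbhd A) (h : V.1 ⊆ U.1), cohMap F n h x = 0 := by
  rw [cohMap_eq_restrH, restrH_eq_zero_iff] at hx
  have hU : U.1 ∈ 𝓝ˢ (Set.range (incl A)) := by rw [range_incl]; exact U.2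
  obtain ⟨B, hB, h⟩ := exists_nhds_pullH_eq_zero n (hA.pcNBasis.toSub hU) _ x hx
  have hB' := image_mem_nhdsSet_range hU hB
  rw [range_incl] at hB'
  have hBU : Subtype.val '' B ⊆ U.1 := by
    rintro _ ⟨b, -, rfl⟩
    exact b.2
  refine ⟨⟨_, hB'⟩, hBU, ?_⟩
  rw [cohMap_eq_restrH, restrH_eq_zero_iff]
  refine h _ (inclOf hBU) fun b => ?_
  obtain ⟨c, hc, hcb⟩ := b.2
  have e : c = inclOf hBU b := Subtype.ext hcb
  exact e ▸ hc

instance (A : Set X) : IsCodirectedOrder (Nbhd A) where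
  directed U V := ⟨⟨U.1 ∩ V.1, Filter.inter_mem U.2 V.2⟩, Set.inter_subset_left,
    Set.inter_subset_right⟩

instance (A : Set X) : Nonempty (Nbhd A) := ⟨⟨Set.univ, Filter.univ_mem⟩⟩

end Tautness

end

end Taut

theorem mainTheorem7 (X : TopCat.{u}) (A : Set X) (hA : Taut.HasPcNBasis A) : Taut.IsTaut A := by
  intro F n
  have hι (U : Taut.Nbhd A) (x : Taut.coh F n U.1) :
      Taut.tautMap F n A (colimit.ι (Taut.nbhdDiagram F n A) (op U) x) =
        Taut.cohMap F n (subset_of_mem_nhdsSet U.2) x :=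
    ConcreteCategory.congr_hom (colimit.ι_desc (Taut.nbhdCocone F n A) (op U)) x
  rw [ConcreteCategory.isIso_iff_bijective]
  constructor
  · rw [injective_iff_map_eq_zero]
    intro t ht
    obtain ⟨⟨U⟩, x, rfl⟩ := Concrete.colimit_exists_rep _ t
    obtain ⟨V, h, hx⟩ := Taut.exists_cohMap_eq_zero hA F n U x ((hι U x).symm.trans ht)
    have hw := ConcreteCategory.congr_hom
      (colimit.w (Taut.nbhdDiagram F n A) (homOfLE (show V ≤ U from h)).op) x
    refine hw.symm.trans ?_
    refine (congrArg (colimit.ι (Taut.nbhdDiagram F n A) (op V)) hx).trans (map_zero _)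
  · intro x
    obtain ⟨U, y, rfl⟩ := Taut.exists_cohMap_eq hA F n x
    exact ⟨_, hι U y⟩
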